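/- Let $q \ge 3$ be an integer and let $\chi$ be a primitive Dirichlet character modulo $q$, with Dirichlet $L$-function $L(s,\chi)$ (analytically continued to $\mathbb{C}$). Then for every $t \in \mathbb{R}$, $$\left|L\left(\tfrac{3}{4}+it,\chi\right)\right|\le 5.13781\,(q|1+it|)^{1/8},$$ $$\left|L\left(\tfrac{7}{8}+it,\chi\right)\right|\le 9.49562\,(q|1+it|)^{1/16},$$ and $$\left|L\left(\tfrac{15}{16}+it,\chi\right)\right|\le 18.23874\,(q|1+it|)^{1/32}.$$ -/

import Mathlib

/-!
The bound is a convexity estimate between the lines `re s = 0` and `re s = 1`. On the right edge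
`|L(1 + i t, χ)|` has no bound independent of `q` and `t`, and on the left edge the functional
equation gives `|L(i t, χ)| = (q / π) ^ (1 / 2) * |Gamma quotient| * |L(1 + i t, χ)|`. A logarithm
is avoided by dividing by an analytic function of which `|L(1 + i t, χ)|` is a factor on both edges:
the quotient

  `F(s) = L(2 - s, χ⁻¹) L(1 + s, χ) / (L(2 + s, χ) L(3 - s, χ⁻¹))`

has modulus `|L(1 + i t, χ) / L(3 + i t, χ)|` for `re s = 0` and for `re s = 1`, because
`|L(conj s, χ⁻¹)| = |L(s, χ)|`, while in the strip the Euler product gives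
`|F(s)| ≤ ζ(2 - σ) ζ(1 + σ) / (ζ(2 + σ) ζ(3 - σ))` (`DirichletCharacter.norm_LFunction_mul_le`).

On the line `re s = 0` the square of the modulus of the Gamma quotient is `(t / 2) coth (π t / 2)`
or `(t / 2) tanh (π t / 2)`, hence at most `(t ^ 2 + 2 / 3) ^ (1 / 2) / 2`
(`norm_Gammaℝ_two_sub_le`, `norm_Gammaℝ_one_sub_le`). It is interpolated by the exponential of a
cubic polynomial (`logComparison`) that depends on the point `s` at which the bound is wanted, and
whose real part there is at most `(1 - σ) / 4 * log (1 + t ^ 2)`.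

So `L / (F * (q / 2π) ^ ((1 - s) / 2) * exp (cubic))` is bounded by `ζ(3)` on both edges. In the
open strip it is `O((1 + |t|) / (σ (1 - σ)) ^ 2)`, by partial summation and Euler products, and the
Phragmén–Lindelöf principle `norm_le_of_edges_of_growth`, which tolerates such singularities at the
edges, extends the bound to the strip. What remains is to evaluate
`ζ(3) ζ(2 - σ) ζ(1 + σ) / (ζ(2 + σ) ζ(3 - σ)) * (2π) ^ (-(1 - σ) / 2)` at the three abscissae; it is
smaller than the required constants by more than three percent even with the simple bounds
`norm_riemannZeta_le` and `le_norm_riemannZeta`.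
-/

/-! ### A Phragmén–Lindelöf principle with singular edges -/

open Complex in
/-- A Phragmén–Lindelöf principle for the strip `0 ≤ re s ≤ 1` in which the growth bound may blow up
at the edges. No bound uniform up to the edges is needed, so the reciprocal of an `L`-function may
be a factor of `f` although no effective lower bound for it on the line `re s = 1` is available.
The proof applies the maximum principle on rectangles of height `T` to `f` times a polynomial that
vanishes at the four corners, and lets `T` tend to infinity. -/
lemma norm_le_of_edges_of_growth {f : ℂ → ℂ} {M C : ℝ}
    (hd : DiffContOnCl ℂ f (re ⁻¹' Set.Ioo 0 1))
    (h0 : ∀ t : ℝ, ‖f (t * I)‖ ≤ M) (h1 : ∀ t : ℝ, ‖f (1 + t * I)‖ ≤ M)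
    (hC : ∀ s : ℂ, 0 < s.re → s.re < 1 →
      ‖f s‖ ≤ C * (1 + |s.im|) / (s.re * (1 - s.re)) ^ 2)
    {s : ℂ} (hs0 : 0 < s.re) (hs1 : s.re < 1) : ‖f s‖ ≤ M := by
  have hM : 0 ≤ M := (norm_nonneg _).trans (h0 0)
  have hC0 : 0 ≤ C := by
    have := (norm_nonneg _).trans (hC (1 / 2) (by norm_num) (by norm_num))
    norm_num at this
    linarith
  -- `K T` has double zeros at the corners `± T * I`, `1 ± T * I` and tends to `1` as `T → ∞`
  set K : ℝ → ℂ → ℂ := fun T z ↦ ((z ^ 2 + T ^ 2) * ((z - 1) ^ 2 + T ^ 2)) ^ 2 / T ^ 8 with hK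
  -- the factor with zeros at the two corners of the same vertical edge
  have hedge : ∀ T t : ℝ, 0 < T → |t| ≤ T → ‖((t * I) ^ 2 + T ^ 2 : ℂ)‖ ≤ T ^ 2 := by
    intro T t hT ht
    have : ((t * I) ^ 2 + T ^ 2 : ℂ) = ((T ^ 2 - t ^ 2 : ℝ) : ℂ) := by
      push_cast; rw [mul_pow, I_sq]; ring
    rw [this, norm_real, Real.norm_eq_abs, abs_le]
    have := sq_le_sq.2 (ht.trans (le_abs_self T))
    constructor <;> nlinarith [sq_nonneg t]
  -- the factor with zeros at the two corners of the opposite edge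
  have hfar : ∀ (T t e : ℝ), 0 < T → |t| ≤ T → e ^ 2 = 1 →
      ‖((e + t * I) ^ 2 + T ^ 2 : ℂ)‖ ≤ (T + 1) ^ 2 := by
    intro T t e hT ht he
    have : ((e + t * I) ^ 2 + T ^ 2 : ℂ) =
        ((t * I) ^ 2 + T ^ 2) + ((e ^ 2 : ℝ) + 2 * e * t * I) := by
      push_cast; ring
    rw [this, he]
    have he' : |e| = 1 := by
      rw [← sq_abs] at he; nlinarith [abs_nonneg e]
    calc _ ≤ T ^ 2 + (1 + 2 * T) := by
          refine (norm_add_le _ _).trans (add_le_add (hedge T t hT ht) ?_)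
          refine (norm_add_le _ _).trans ?_
          simp [he', ht]
      _ = _ := by ring
  have hKdiff : ∀ T, Differentiable ℂ (K T) := fun T ↦ by fun_prop
  -- bound on the rectangle of height `T`
  have key : ∀ T : ℝ, 1 ≤ T → |s.im| < T →
      ‖f s * K T s‖ ≤ max (M * (1 + 1 / T) ^ 4) (C * 162 / T ^ 3) := by
    intro T hT hsT
    have hT0 : 0 < T := by linarith
    have hsub : (Set.Ioo 0 1 ×ℂ Set.Ioo (-T) T) ⊆ re ⁻¹' Set.Ioo (0 : ℝ) 1 := fun z hz ↦ hz.1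
    refine norm_le_of_forall_mem_frontier_norm_le (U := Set.Ioo 0 1 ×ℂ Set.Ioo (-T) T)
      ((Metric.isBounded_Ioo 0 1).reProdIm (Metric.isBounded_Ioo (-T) T))
      ((hd.mono hsub).smul (hKdiff T).diffContOnCl) ?_
      (subset_closure ⟨⟨hs0, hs1⟩, abs_lt.1 hsT⟩)
    intro z hz
    rw [frontier_reProdIm, closure_Ioo zero_ne_one, frontier_Ioo zero_lt_one,
      closure_Ioo (by linarith), frontier_Ioo (by linarith)] at hz
    have hT8 : ‖(T : ℂ) ^ 8‖ = T ^ 8 := by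
      rw [norm_pow, norm_real, Real.norm_eq_abs, abs_of_pos hT0]
    have hside : ∀ A B : ℂ, ‖A‖ ≤ T ^ 2 → ‖B‖ ≤ (T + 1) ^ 2 →
        ‖(A * B) ^ 2 / (T : ℂ) ^ 8‖ ≤ (1 + 1 / T) ^ 4 := by
      intro A B hA hB
      rw [norm_div, hT8, norm_pow, norm_mul, div_le_iff₀ (by positivity)]
      calc (‖A‖ * ‖B‖) ^ 2 ≤ (T ^ 2 * (T + 1) ^ 2) ^ 2 := by gcongr
        _ = _ := by field_simp
    rw [smul_eq_mul, norm_mul]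
    rcases hz with ⟨hz1, hz2⟩ | ⟨hz1, hz2⟩
    · -- horizontal sides: a corner factor compensates the blow-up of the growth bound
      have hz1' : 0 ≤ z.re ∧ z.re ≤ 1 := hz1
      have him : z.im ^ 2 = T ^ 2 := by
        rcases hz2 with h | h <;> rw [h]; ring
      have habs : |z.im| = T := by
        rw [← sq_eq_sq₀ (abs_nonneg _) hT0.le, sq_abs, him]
      have hfac : ∀ a : ℝ, |a| ≤ 1 →
          ‖((a + z.im * I) ^ 2 + T ^ 2 : ℂ)‖ ≤ |a| * (3 * T) := by
        intro a ha
        have : ((a + z.im * I) ^ 2 + T ^ 2 : ℂ) = a * (a + 2 * z.im * I) := by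
          have h2 : (T : ℂ) ^ 2 = (z.im : ℂ) ^ 2 := by exact_mod_cast him.symm
          rw [h2]; ring_nf; rw [I_sq]; ring
        rw [this, norm_mul, norm_real, Real.norm_eq_abs]
        gcongr
        refine (norm_add_le _ _).trans ?_
        simp [habs]; linarith
      have e1 : (z ^ 2 + T ^ 2 : ℂ) = (z.re + z.im * I) ^ 2 + T ^ 2 := by rw [re_add_im]
      have e2 : ((z - 1) ^ 2 + T ^ 2 : ℂ) = ((z.re - 1 : ℝ) + z.im * I) ^ 2 + T ^ 2 := by
        conv_lhs => rw [← re_add_im z]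
        push_cast; ring
      have b1 := hfac z.re (by rw [abs_of_nonneg hz1'.1]; exact hz1'.2)
      have b2 := hfac (z.re - 1) (by rw [abs_le]; constructor <;> linarith)
      rw [← e1, abs_of_nonneg hz1'.1] at b1
      rw [← e2, abs_of_nonpos (by linarith), neg_sub] at b2
      have bK : ‖K T z‖ ≤ (z.re * (3 * T) * ((1 - z.re) * (3 * T))) ^ 2 / T ^ 8 := by
        rw [hK]
        simp only
        rw [norm_div, hT8, norm_pow, norm_mul]
        have := hz1'.1
        gcongr
      refine le_max_of_le_right ?_
      rcases hz1'.1.eq_or_lt with h | hr0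
      · rw [← h] at bK
        have : ‖K T z‖ = 0 := le_antisymm (by simpa using bK) (norm_nonneg _)
        rw [this, mul_zero]; positivity
      rcases hz1'.2.eq_or_lt with h | hr1
      · rw [h] at bK
        have : ‖K T z‖ = 0 := le_antisymm (by simpa using bK) (norm_nonneg _)
        rw [this, mul_zero]; positivity
      have hr1' : 0 < 1 - z.re := by linarith
      calc ‖f z‖ * ‖K T z‖ ≤ (C * (1 + |z.im|) / (z.re * (1 - z.re)) ^ 2) *
            ((z.re * (3 * T) * ((1 - z.re) * (3 * T))) ^ 2 / T ^ 8) := by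
            gcongr
            exact hC z hr0 hr1
        _ = C * 81 * (1 + T) / T ^ 4 := by rw [habs]; field_simp; ring
        _ ≤ C * 81 * (T + T) / T ^ 4 := by gcongr
        _ = _ := by field_simp; ring
    · refine le_max_of_le_left ?_
      have hz2' : |z.im| ≤ T := abs_le.2 hz2
      rcases hz1 with h | h
      · have hz' : z = z.im * I := by
          conv_lhs => rw [← re_add_im z]
          rw [h]; simp
        have hf := h0 z.im
        rw [← hz'] at hf
        have hk : ‖K T z‖ ≤ (1 + 1 / T) ^ 4 := by
          refine hside _ _ ?_ ?_
          · rw [hz']; exact hedge T z.im hT0 hz2'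
          · have := hfar T z.im (-1) hT0 hz2' (by norm_num)
            convert! this using 3
            rw [hz']; push_cast; simp; ring
        gcongr
      · have hz' : z = 1 + z.im * I := by
          conv_lhs => rw [← re_add_im z]
          rw [h]; simp
        have hf := h1 z.im
        rw [← hz'] at hf
        have hk : ‖K T z‖ ≤ (1 + 1 / T) ^ 4 := by
          rw [hK]
          simp only
          rw [mul_comm (z ^ 2 + _)]
          refine hside _ _ ?_ ?_
          · have := hedge T z.im hT0 hz2'
            convert! this using 3
            rw [hz']; simp
          · have := hfar T z.im 1 hT0 hz2' (by norm_num)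
            convert! this using 3
            rw [hz']; simp
        gcongr
  have hinv : Filter.Tendsto (fun T : ℝ ↦ 1 / T) Filter.atTop (nhds 0) := by
    simpa using tendsto_inv_atTop_zero (𝕜 := ℝ)
  have limR : Filter.Tendsto (fun T : ℝ ↦ max (M * (1 + 1 / T) ^ 4) (C * 162 / T ^ 3))
      Filter.atTop (nhds (max (M * (1 + 0) ^ 4) (C * 162 * 0 ^ 3))) := by
    refine Filter.Tendsto.max (((hinv.const_add 1).pow 4).const_mul M) ?_
    refine ((hinv.pow 3).const_mul (C * 162)).congr fun T ↦ ?_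
    rw [one_div, inv_pow, div_eq_mul_inv]
  have hinvC : Filter.Tendsto (fun T : ℝ ↦ (((1 / T : ℝ) : ℂ))) Filter.atTop (nhds 0) := by
    rw [← ofReal_zero]
    exact (continuous_ofReal.tendsto 0).comp hinv
  have limL : Filter.Tendsto (fun T : ℝ ↦ ‖f s * K T s‖) Filter.atTop (nhds ‖f s * 1‖) := by
    refine (Filter.Tendsto.const_mul _ ?_).norm
    have : Filter.Tendsto (fun T : ℝ ↦ ((s ^ 2 * ((1 / T : ℝ) : ℂ) ^ 2 + 1) *
        ((s - 1) ^ 2 * ((1 / T : ℝ) : ℂ) ^ 2 + 1)) ^ 2) Filter.atTop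
        (nhds (((s ^ 2 * 0 ^ 2 + 1) * ((s - 1) ^ 2 * 0 ^ 2 + 1)) ^ 2)) :=
      ((((hinvC.pow 2).const_mul _).add_const 1).mul
        (((hinvC.pow 2).const_mul _).add_const 1)).pow 2
    simp only [ne_eq, OfNat.ofNat_ne_zero, not_false_eq_true, zero_pow, mul_zero, zero_add,
      one_pow, mul_one] at this
    refine this.congr' ?_
    filter_upwards [Filter.eventually_gt_atTop 0] with T hT
    have : (T : ℂ) ≠ 0 := ofReal_ne_zero.2 hT.ne'
    rw [hK]
    push_cast
    field_simp
  have := le_of_tendsto_of_tendsto limL limR (by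
    filter_upwards [Filter.eventually_ge_atTop 1, Filter.eventually_gt_atTop |s.im|] with T h1 h2
    exact key T h1 h2)
  simpa [hM] using this

/-! ### Gamma factors on the line `re s = 0` -/

open Complex in
lemma norm_Gammaℝ_one_add_mul_I_sq (t : ℝ) :
    ‖Gammaℝ (1 + t * I)‖ ^ 2 = 1 / Real.cosh (Real.pi * t / 2) := by
  have h := Gammaℝ_one_sub_mul_Gammaℝ_one_add (t * I)
  have hc : (1 - t * I : ℂ) = (starRingEnd ℂ) (1 + t * I) := by simp [sub_eq_add_neg]
  have hG : Gammaℝ ((starRingEnd ℂ) (1 + t * I)) = (starRingEnd ℂ) (Gammaℝ (1 + t * I)) := by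
    have harg : arg (Real.pi : ℂ) ≠ Real.pi := by
      rw [arg_ofReal_of_nonneg Real.pi_pos.le]; exact Real.pi_pos.ne
    have e : ∀ z : ℂ, -(starRingEnd ℂ) z / 2 = (starRingEnd ℂ) (-z / 2) :=
      fun z ↦ by simp [map_ofNat]
    rw [Gammaℝ_def, Gammaℝ_def, map_mul, ← Gamma_conj, e, cpow_conj _ _ harg, conj_ofReal]
    simp [map_ofNat]
  rw [hc, hG, mul_comm, mul_conj, normSq_eq_norm_sq] at h
  have h2 : (Real.pi * (t * I) / 2 : ℂ) = ((Real.pi * t / 2 : ℝ) : ℂ) * I := by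
    push_cast; ring
  rw [h2, cos_mul_I, ← ofReal_cosh, ← ofReal_inv] at h
  rw [one_div]
  exact_mod_cast h

open Complex in
lemma norm_Gammaℝ_two_sub_mul_I_sq {t : ℝ} (ht : t ≠ 0) :
    ‖Gammaℝ (2 - t * I)‖ ^ 2 = t / (2 * Real.pi * Real.sinh (Real.pi * t / 2)) := by
  set y : ℝ := t / 2 with hy
  have hy0 : y ≠ 0 := by rw [hy]; positivity
  have h := Complex.Gamma_mul_Gamma_one_sub (y * I)
  have hI : (y * I : ℂ) ≠ 0 := mul_ne_zero (ofReal_ne_zero.2 hy0) I_ne_zero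
  have hs : sin (Real.pi * (y * I)) = (Real.sinh (Real.pi * y) : ℂ) * I := by
    rw [← mul_assoc, ← ofReal_mul, sin_mul_I, ofReal_sinh]
  have hsh : Real.sinh (Real.pi * y) ≠ 0 := by
    rw [Real.sinh_ne_zero]; exact mul_ne_zero Real.pi_ne_zero hy0
  have hG : Gamma (1 + y * I) * Gamma (1 - y * I) =
      ((Real.pi * y / Real.sinh (Real.pi * y) : ℝ) : ℂ) := by
    rw [add_comm, Gamma_add_one _ hI, mul_assoc, h, hs]
    have : (Real.sinh (Real.pi * y) : ℂ) ≠ 0 := ofReal_ne_zero.2 hsh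
    push_cast at this ⊢
    field_simp
  have hc : (1 + y * I : ℂ) = (starRingEnd ℂ) (1 - y * I) := by simp [sub_eq_add_neg]
  rw [hc, Gamma_conj, mul_comm, mul_conj, normSq_eq_norm_sq] at hG
  have hG' : ‖Gamma (1 - y * I)‖ ^ 2 = Real.pi * y / Real.sinh (Real.pi * y) := by
    exact_mod_cast hG
  rw [Gammaℝ_def, norm_mul, mul_pow, norm_cpow_eq_rpow_re_of_pos Real.pi_pos]
  have e1 : ((2 - t * I) / 2 : ℂ) = 1 - y * I := by rw [hy]; push_cast; ring
  have e2 : (-(2 - t * I) / 2 : ℂ).re = -1 := by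
    rw [neg_div, e1]; simp
  rw [e1, e2, hG', Real.rpow_neg_one]
  have e3 : Real.pi * t / 2 = Real.pi * y := by rw [hy]; ring
  rw [e3, show t = 2 * y by rw [hy]; ring]
  field_simp

open Complex in
lemma norm_Gammaℝ_mul_I_sq {t : ℝ} (ht : t ≠ 0) :
    ‖Gammaℝ (t * I)‖ ^ 2 = 2 * Real.pi / (t * Real.sinh (Real.pi * t / 2)) := by
  have hI : (((-t : ℝ) : ℂ) * I) ≠ 0 := mul_ne_zero (ofReal_ne_zero.2 (neg_ne_zero.2 ht)) I_ne_zero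
  have h := norm_Gammaℝ_two_sub_mul_I_sq (neg_ne_zero.2 ht)
  have e : (2 - ((-t : ℝ) : ℂ) * I) = t * I + 2 := by push_cast; ring
  have hI : (t * I : ℂ) ≠ 0 := mul_ne_zero (ofReal_ne_zero.2 ht) I_ne_zero
  have hsh : Real.sinh (Real.pi * t / 2) ≠ 0 := by
    rw [Real.sinh_ne_zero]; have := Real.pi_ne_zero; positivity
  rw [e, Gammaℝ_add_two hI] at h
  simp only [norm_div, norm_mul, norm_I, norm_real, mul_one, Real.norm_eq_abs, div_pow, mul_pow,
    sq_abs, norm_ofNat] at h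
  rw [show Real.pi * -t / 2 = -(Real.pi * t / 2) by ring, Real.sinh_neg] at h
  have := Real.pi_ne_zero
  field_simp at h ⊢
  linarith

lemma sq_div_sinh_sq_le (x : ℝ) : x ^ 2 / Real.sinh x ^ 2 ≤ 1 := by
  refine div_le_one_of_le₀ ?_ (sq_nonneg _)
  rw [sq_le_sq, Real.abs_sinh]
  exact Real.self_le_sinh_iff.2 (abs_nonneg x)

open Complex in
/-- Quotient of the Gamma factors of an odd character on the line `re s = 0`. By the reflection
formula the square of the quotient is `t / (2 π) * coth (π t / 2)`, and
`x ^ 2 * coth x ^ 2 = x ^ 2 + x ^ 2 / sinh x ^ 2 ≤ x ^ 2 + 1`. -/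
lemma norm_Gammaℝ_two_sub_le (t : ℝ) :
    ‖Gammaℝ (2 - t * I)‖ ^ 4 ≤
      (t ^ 2 + 2 / 3) / (2 * Real.pi) ^ 2 * ‖Gammaℝ (1 + t * I)‖ ^ 4 := by
  have hpi := Real.pi_gt_three
  have hpi2 : 6 ≤ Real.pi ^ 2 := by nlinarith
  rcases eq_or_ne t 0 with rfl | ht
  · have : ‖Gammaℝ 2‖ = Real.pi⁻¹ := by
      rw [Gammaℝ_def]
      norm_num
      rw [cpow_neg_one, norm_inv, norm_real, Real.norm_eq_abs, abs_of_pos Real.pi_pos]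
    simp only [ofReal_zero, zero_mul, sub_zero, this, add_zero, Gammaℝ_one, norm_one]
    have : (Real.pi⁻¹) ^ 4 = 1 / (Real.pi ^ 2 * Real.pi ^ 2) := by field_simp
    rw [this, div_mul_eq_mul_div, div_le_div_iff₀ (by positivity) (by positivity)]
    nlinarith [Real.pi_pos]
  have e : ∀ x : ℝ, x ^ 4 = (x ^ 2) ^ 2 := fun x ↦ by ring
  rw [e, e ‖Gammaℝ (1 + _)‖, norm_Gammaℝ_two_sub_mul_I_sq ht, norm_Gammaℝ_one_add_mul_I_sq]
  have hch := Real.cosh_pos (Real.pi * t / 2)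
  have hsq := Real.cosh_sq (Real.pi * t / 2)
  have hle := sq_div_sinh_sq_le (Real.pi * t / 2)
  have hsh : Real.sinh (Real.pi * t / 2) ≠ 0 := by
    rw [Real.sinh_ne_zero]; positivity
  set c := Real.cosh (Real.pi * t / 2)
  set s := Real.sinh (Real.pi * t / 2)
  have hs2 : 0 < s ^ 2 := by positivity
  rw [div_le_one hs2] at hle
  have key : t ^ 2 ≤ 2 / 3 * s ^ 2 := by
    have : 6 * t ^ 2 ≤ Real.pi ^ 2 * t ^ 2 := by gcongr
    nlinarith
  rw [div_pow, one_div, inv_pow, ← div_eq_mul_inv, div_div, div_le_div_iff₀ (by positivity)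
    (by positivity), hsq]
  nlinarith [mul_nonneg (sq_nonneg Real.pi) (sub_nonneg.2 key),
    mul_nonneg (mul_nonneg (sq_nonneg Real.pi) (sub_nonneg.2 key)) (sq_nonneg s)]

open Complex in
/-- Quotient of the Gamma factors of an even character on the line `re s = 0`; its square is
`t / (2 π) * tanh (π t / 2)`. For `t = 0` the right-hand side would be `0`, as `Gammaℝ` has a pole
there and takes the value `0`. -/
lemma norm_Gammaℝ_one_sub_le {t : ℝ} (ht : t ≠ 0) :
    ‖Gammaℝ (1 - t * I)‖ ^ 4 ≤
      (t ^ 2 + 2 / 3) / (2 * Real.pi) ^ 2 * ‖Gammaℝ (t * I)‖ ^ 4 := by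
  have e : ∀ x : ℝ, x ^ 4 = (x ^ 2) ^ 2 := fun x ↦ by ring
  have h1 := norm_Gammaℝ_one_add_mul_I_sq (-t)
  rw [show (1 + ((-t : ℝ) : ℂ) * I) = 1 - t * I by push_cast; ring,
    show Real.pi * -t / 2 = -(Real.pi * t / 2) by ring, Real.cosh_neg] at h1
  rw [e, e ‖Gammaℝ (t * I)‖, h1, norm_Gammaℝ_mul_I_sq ht]
  have hch := Real.cosh_pos (Real.pi * t / 2)
  have hsq := Real.cosh_sq (Real.pi * t / 2)
  have hsh : Real.sinh (Real.pi * t / 2) ≠ 0 := by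
    rw [Real.sinh_ne_zero]; have := Real.pi_ne_zero; positivity
  set c := Real.cosh (Real.pi * t / 2)
  set s := Real.sinh (Real.pi * t / 2)
  have e2 : (t ^ 2 + 2 / 3) / (2 * Real.pi) ^ 2 * (2 * Real.pi / (t * s)) ^ 2 =
      (t ^ 2 + 2 / 3) / (t ^ 2 * s ^ 2) := by
    have := Real.pi_ne_zero
    field_simp
  have hs2 : 0 < s ^ 2 := by positivity
  have ht2 : 0 < t ^ 2 := by positivity
  rw [e2, div_pow, one_pow, div_le_div_iff₀ (by positivity) (by positivity), hsq]
  nlinarith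

/-! ### Root numbers and complex conjugation -/

namespace DirichletCharacter

variable {N : ℕ}

lemma IsPrimitive.inv {χ : DirichletCharacter ℂ N} (hχ : χ.IsPrimitive) :
    (χ⁻¹).IsPrimitive := by
  rw [isPrimitive_def, conductor_inv]; exact hχ

variable [NeZero N]

lemma norm_gaussSum_inv (χ : DirichletCharacter ℂ N) :
    ‖gaussSum χ⁻¹ ZMod.stdAddChar‖ = ‖gaussSum χ ZMod.stdAddChar‖ := by
  have h := star_gaussSum_eq χ ZMod.stdAddChar
  have h2 := gaussSum_mulShift χ⁻¹ (ZMod.stdAddChar (N := N)) (-1)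
  have h3 : (ZMod.stdAddChar (N := N)).mulShift ((-1 : (ZMod N)ˣ) : ZMod N) =
      ZMod.stdAddChar⁻¹ := by
    rw [AddChar.inv_mulShift]; simp
  rw [h3, ← h] at h2
  rw [← h2, norm_mul, norm_star, unit_norm_eq_one, one_mul]

lemma norm_rootNumber_inv (χ : DirichletCharacter ℂ N) :
    ‖rootNumber χ⁻¹‖ = ‖rootNumber χ‖ := by
  simp only [rootNumber, norm_div, norm_gaussSum_inv, norm_pow, Complex.norm_I, one_pow]

lemma completedLFunction_two_ne_zero (χ : DirichletCharacter ℂ N) :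
    completedLFunction χ 2 ≠ 0 := by
  intro h
  have := LFunction_eq_completed_div_gammaFactor χ 2 (Or.inl two_ne_zero)
  rw [h, zero_div] at this
  exact LFunction_ne_zero_of_one_le_re χ (Or.inr (by norm_num)) (by norm_num) this

/-- The functional equation used twice gives `rootNumber χ * rootNumber χ⁻¹ = 1`, and the two
factors have the same modulus. -/
lemma IsPrimitive.norm_rootNumber {χ : DirichletCharacter ℂ N} (hχ : χ.IsPrimitive) :
    ‖rootNumber χ‖ = 1 := by
  have h1 := hχ.completedLFunction_one_sub (-1)
  have h2 := hχ.inv.completedLFunction_one_sub 2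
  rw [inv_inv] at h2
  norm_num at h1 h2
  rw [h2] at h1
  have hne := completedLFunction_two_ne_zero χ
  have hN0 : (N : ℂ) ≠ 0 := NeZero.ne _
  have hp : (N : ℂ) ^ (-(3 / 2) : ℂ) * (N : ℂ) ^ (3 / 2 : ℂ) = 1 := by
    rw [← Complex.cpow_add _ _ hN0]; simp
  have h3 : rootNumber χ * rootNumber χ⁻¹ = 1 := by
    apply mul_right_cancel₀ hne
    rw [one_mul]
    conv_rhs => rw [h1]
    linear_combination (-(rootNumber χ * rootNumber χ⁻¹ * completedLFunction χ 2)) * hp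
  have h4 : ‖rootNumber χ‖ * ‖rootNumber χ‖ = 1 := by
    conv_lhs => rw [← norm_rootNumber_inv χ]
    rw [norm_rootNumber_inv χ]
    nth_rewrite 2 [← norm_rootNumber_inv χ]
    rw [← norm_mul, h3, norm_one]
  nlinarith [norm_nonneg (rootNumber χ)]

lemma norm_LFunction_inv_conj_of_one_lt_re (χ : DirichletCharacter ℂ N) {s : ℂ} (hs : 1 < s.re) :
    ‖LFunction χ⁻¹ ((starRingEnd ℂ) s)‖ = ‖LFunction χ s‖ := by
  rw [LFunction_eq_LSeries _ hs, LFunction_eq_LSeries _ (by simpa using hs),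
    ← norm_star (LSeries _ s)]
  congr 1
  rw [LSeries, LSeries, tsum_star]
  refine tsum_congr fun n ↦ ?_
  rcases eq_or_ne n 0 with rfl | hn
  · simp
  rw [LSeries.term_of_ne_zero hn, LSeries.term_of_ne_zero hn, star_div₀, MulChar.star_apply']
  congr 1
  change _ = (starRingEnd ℂ) _
  rw [Complex.cpow_conj _ _ (by rw [Complex.natCast_arg]; exact Real.pi_pos.ne),
    Complex.conj_natCast]

/-- The relation `L(χ⁻¹, conj s) = conj L(χ, s)` in modulus, on the line `re s = 1`, where it holds
by continuity. -/
lemma norm_LFunction_inv_conj {χ : DirichletCharacter ℂ N} (hχ : χ ≠ 1) (t : ℝ) :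
    ‖LFunction χ⁻¹ (1 - t * Complex.I)‖ = ‖LFunction χ (1 + t * Complex.I)‖ := by
  have hχ' : χ⁻¹ ≠ 1 := inv_ne_one.2 hχ
  have h1 : Continuous fun a : ℝ ↦ ‖LFunction χ (a + t * Complex.I)‖ :=
    ((differentiable_LFunction hχ).continuous.comp (by fun_prop)).norm
  have h2 : Continuous fun a : ℝ ↦ ‖LFunction χ⁻¹ (a - t * Complex.I)‖ :=
    ((differentiable_LFunction hχ').continuous.comp (by fun_prop)).norm
  have h3 : Set.EqOn (fun a : ℝ ↦ ‖LFunction χ⁻¹ (a - t * Complex.I)‖)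
      (fun a : ℝ ↦ ‖LFunction χ (a + t * Complex.I)‖) (closure (Set.Ioi 1)) := by
    refine Set.EqOn.closure (fun a ha ↦ ?_) h2 h1
    have := norm_LFunction_inv_conj_of_one_lt_re χ (s := a + t * Complex.I) (by simpa using ha)
    simpa [sub_eq_add_neg] using this
  rw [closure_Ioi] at h3
  simpa using h3 (Set.self_mem_Ici (a := (1 : ℝ)))

end DirichletCharacter

/-! ### Growth of the `L`-function in the right half-plane -/

namespace DirichletCharacter

variable {N : ℕ} [NeZero N]

/-- The partial sums are periodic in `n`, because the sum over a period vanishes. -/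
lemma norm_sum_range_le {χ : DirichletCharacter ℂ N} (hχ : χ ≠ 1) (n : ℕ) :
    ‖∑ k ∈ Finset.range n, χ k‖ ≤ N := by
  have hN : ∑ k ∈ Finset.range N, χ (k : ZMod N) = 0 := by
    rw [← χ.sum_eq_zero_of_ne_one hχ]
    refine Finset.sum_bij' (fun k _ ↦ (k : ZMod N)) (fun a _ ↦ a.val) ?_ ?_ ?_ ?_ ?_
    · simp
    · intro a _; simpa using ZMod.val_lt a
    · intro k hk; exact ZMod.val_cast_of_lt (Finset.mem_range.1 hk)
    · simp
    · simp
  induction n using Nat.strong_induction_on with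
  | _ n ih =>
    rcases lt_or_ge n N with h | h
    · refine (norm_sum_le_of_le _ (fun k _ ↦ χ.norm_le_one _)).trans ?_
      simpa using h.le
    · obtain ⟨m, rfl⟩ := Nat.exists_eq_add_of_le h
      rw [Finset.sum_range_add, hN, zero_add]
      have := ih m (by have := NeZero.pos N; omega)
      simpa using this

lemma norm_sum_Icc_le {χ : DirichletCharacter ℂ N} (hχ : χ ≠ 1) (n : ℕ) :
    ‖∑ k ∈ Finset.Icc 1 n, χ k‖ ≤ N := by
  have h := norm_sum_range_le hχ (n + 1)
  have hN : N ≠ 1 := fun h1 ↦ hχ (χ.level_one' h1)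
  rwa [Finset.range_eq_Ico, Finset.sum_eq_sum_Ico_succ_bot (Nat.succ_pos n), Nat.cast_zero,
    χ.map_zero' hN, zero_add, zero_add, Nat.succ_eq_add_one, Finset.Ico_add_one_right_eq_Icc] at h

open Complex MeasureTheory Set Asymptotics Filter in
/-- The formula for `L(s, χ)` obtained by partial summation, extended from `1 < re s` to `0 < re s`:
the right-hand side is `s` times a Mellin transform at `-s`, hence analytic. -/
lemma LFunction_eq_mul_mellin {χ : DirichletCharacter ℂ N} (hχ : χ ≠ 1) {s : ℂ}
    (hs : 0 < s.re) :
    LFunction χ s = s * ∫ t in Ioi (1 : ℝ),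
      (∑ k ∈ Finset.Icc 1 ⌊t⌋₊, χ k) * (t : ℂ) ^ (-(s + 1)) := by
  set f : ℝ → ℂ := fun t ↦ ∑ k ∈ Finset.Icc 1 ⌊t⌋₊, χ k with hf
  have hfN : ∀ t, ‖f t‖ ≤ N := fun t ↦ norm_sum_Icc_le hχ _
  have hf0 : ∀ t < 1, f t = 0 := fun t ht ↦ by
    simp [hf, Nat.floor_eq_zero.2 ht]
  have hmeas : Measurable f :=
    (measurable_from_nat (f := fun n ↦ ∑ k ∈ Finset.Icc 1 n, χ k)).comp Nat.measurable_floor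
  have hloc : LocallyIntegrableOn f (Ioi 0) :=
    ((locallyIntegrable_const (N : ℝ)).mono hmeas.aestronglyMeasurable
      (Eventually.of_forall fun t ↦ by simpa using hfN t)).locallyIntegrableOn _
  have hmel : ∀ z : ℂ, mellin f (-z) = ∫ t in Ioi (1 : ℝ), f t * (t : ℂ) ^ (-(z + 1)) := by
    intro z
    rw [mellin, ← integral_indicator measurableSet_Ioi, ← integral_indicator measurableSet_Ioi]
    refine integral_congr_ae ?_
    filter_upwards [Measure.ae_ne volume (1 : ℝ)] with t ht
    rcases lt_or_gt_of_ne ht with h | h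
    · rw [indicator_of_notMem (s := Ioi 1) (by simpa using h.le), indicator_apply, hf0 t h]
      simp
    · rw [indicator_of_mem (mem_Ioi.2 (by linarith)), indicator_of_mem (mem_Ioi.2 h), smul_eq_mul,
        mul_comm, neg_add']
  have hdiff : ∀ z : ℂ, 0 < z.re → DifferentiableAt ℂ (fun w ↦ w * mellin f (-w)) z := by
    intro z hz
    refine differentiableAt_id.mul (DifferentiableAt.comp z (g := mellin f) ?_
      differentiable_neg.differentiableAt)
    -- the partial sums are bounded at infinity and vanish near `0`
    refine mellin_differentiableAt_of_isBigO_rpow (a := 0) (b := -z.re - 1) hloc ?_ (by simpa) ?_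
      (by simp)
    · refine IsBigO.of_bound N (Eventually.of_forall fun t ↦ ?_)
      simpa using hfN t
    · refine IsBigO.of_bound 0 ?_
      filter_upwards [nhdsWithin_le_nhds (Iio_mem_nhds (zero_lt_one' ℝ))] with t ht
      simp [hf0 t ht]
  have hconv : IsPreconnected {z : ℂ | 0 < z.re} := (convex_halfSpace_re_gt 0).isPreconnected
  have hopen : IsOpen {z : ℂ | 0 < z.re} := isOpen_lt continuous_const continuous_re
  have heq := AnalyticOnNhd.eqOn_of_preconnected_of_eventuallyEq (𝕜 := ℂ)
    (f := LFunction χ) (g := fun w ↦ w * mellin f (-w)) (U := {z : ℂ | 0 < z.re}) (z₀ := 2)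
    ((differentiable_LFunction hχ).differentiableOn.analyticOnNhd hopen)
    ((show DifferentiableOn ℂ _ _ from
      fun z hz ↦ (hdiff z hz).differentiableWithinAt).analyticOnNhd hopen)
    hconv (by simp) (by
      have : {z : ℂ | 1 < z.re} ∈ nhds (2 : ℂ) :=
        (isOpen_lt continuous_const continuous_re).mem_nhds (by simp)
      filter_upwards [this] with z hz
      rw [LFunction_eq_LSeries χ hz, hmel]
      refine LSeries_eq_mul_integral _ le_rfl (zero_lt_one.trans hz)
        (LSeriesSummable_of_one_lt_re χ hz) ?_
      refine IsBigO.of_bound N (Eventually.of_forall fun n ↦ ?_)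
      simpa using norm_sum_Icc_le hχ n)
  rw [← hmel]
  exact heq hs

open Complex MeasureTheory Set in
lemma norm_LFunction_le_of_re_pos {χ : DirichletCharacter ℂ N} (hχ : χ ≠ 1) {s : ℂ}
    (hs : 0 < s.re) : ‖LFunction χ s‖ ≤ N * ‖s‖ / s.re := by
  rw [LFunction_eq_mul_mellin hχ hs, norm_mul, mul_comm (N : ℝ), mul_div_assoc]
  gcongr
  have hint : ∫ t in Ioi (1 : ℝ), (N : ℝ) * t ^ (-(s.re + 1)) = N / s.re := by
    rw [integral_const_mul, integral_Ioi_rpow_of_lt (by linarith) one_pos]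
    simp
    rfl
  rw [← hint]
  refine norm_integral_le_of_norm_le
    ((integrableOn_Ioi_rpow_of_lt (by linarith) one_pos).const_mul _) ?_
  filter_upwards [ae_restrict_mem measurableSet_Ioi] with t ht
  rw [norm_mul, norm_cpow_eq_rpow_re_of_pos (zero_lt_one.trans ht)]
  have := norm_sum_Icc_le hχ ⌊t⌋₊
  simp only [neg_re, add_re, one_re]
  have := Real.rpow_nonneg (zero_lt_one.trans ht).le (-(s.re + 1))
  gcongr

end DirichletCharacter

/-! ### Comparison with the zeta function through Euler products -/

section EulerProduct

open Complex Filter Topology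

/-- Comparison of Euler factors: on the closed unit disc `|(1 - u x) / (1 - u y)|` is largest at
`u = 1`. -/
lemma norm_one_sub_mul_le {u : ℂ} (hu : ‖u‖ ≤ 1) {x y : ℝ} (hx : 0 < x) (hxy : x ≤ y)
    (hy : y < 1) : ‖1 - u * x‖ * (1 - y) ≤ (1 - x) * ‖1 - u * y‖ := by
  have hy0 : 0 < y := hx.trans_le hxy
  -- `(1 - u x) / (1 - u y)` is a convex combination of `1` and `1 / (1 - u y)`
  have h : (1 - u * x : ℂ) = ((x / y : ℝ) : ℂ) * (1 - u * y) + ((1 - x / y : ℝ) : ℂ) := by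
    have : (y : ℂ) ≠ 0 := ofReal_ne_zero.2 hy0.ne'
    push_cast; field_simp; ring
  have hxy1 : 0 ≤ 1 - x / y := sub_nonneg.2 ((div_le_one hy0).2 hxy)
  have h1 : ‖1 - u * x‖ ≤ x / y * ‖1 - u * y‖ + (1 - x / y) := by
    rw [h]
    refine (norm_add_le _ _).trans_eq ?_
    rw [norm_mul, norm_real, norm_real, Real.norm_of_nonneg (by positivity),
      Real.norm_of_nonneg hxy1]
  have h2 : 1 - y ≤ ‖1 - u * y‖ := by
    have h := norm_sub_norm_le (1 : ℂ) (u * y)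
    rw [norm_one, norm_mul, norm_real, Real.norm_of_nonneg hy0.le] at h
    nlinarith
  calc ‖1 - u * x‖ * (1 - y) ≤ (x / y * ‖1 - u * y‖ + (1 - x / y)) * (1 - y) := by
        gcongr
    _ = x / y * (1 - y) * ‖1 - u * y‖ + (1 - x / y) * (1 - y) := by ring
    _ ≤ x / y * (1 - y) * ‖1 - u * y‖ + (1 - x / y) * ‖1 - u * y‖ := by gcongr
    _ = (1 - x) * ‖1 - u * y‖ := by field_simp; ring

namespace DirichletCharacter

variable {N : ℕ}

lemma tendsto_norm_eulerProduct [NeZero N] (χ : DirichletCharacter ℂ N) {a t : ℝ} (ha : 1 < a) :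
    Tendsto (fun n : ℕ ↦ ∏ p ∈ Nat.primesBelow n,
      ‖1 - (χ p * (p : ℂ) ^ (-(t * I))) * ((p : ℝ) ^ (-a) : ℝ)‖⁻¹) atTop
      (𝓝 ‖LFunction χ (a + t * I)‖) := by
  have hs : 1 < (a + t * I : ℂ).re := by simpa using ha
  rw [LFunction_eq_LSeries χ hs]
  refine (LSeries_eulerProduct χ hs).norm.congr fun n ↦ ?_
  rw [norm_prod]
  refine Finset.prod_congr rfl fun p hp ↦ ?_
  have hp0 : (p : ℂ) ≠ 0 := Nat.cast_ne_zero.2 (Nat.prime_of_mem_primesBelow hp).ne_zero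
  rw [norm_inv, neg_add, cpow_add _ _ hp0, ofReal_cpow (Nat.cast_nonneg p)]
  push_cast
  ring_nf

lemma _root_.tendsto_eulerProduct_norm_riemannZeta {a : ℝ} (ha : 1 < a) :
    Tendsto (fun n : ℕ ↦ ∏ p ∈ Nat.primesBelow n, (1 - (p : ℝ) ^ (-a))⁻¹) atTop
      (𝓝 ‖riemannZeta a‖) := by
  refine (riemannZeta_eulerProduct (s := a) (by simpa using ha)).norm.congr fun n ↦ ?_
  rw [norm_prod]
  refine Finset.prod_congr rfl fun p hp ↦ ?_
  have hp1 : (1 : ℝ) < p := by exact_mod_cast (Nat.prime_of_mem_primesBelow hp).one_lt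
  have : (p : ℝ) ^ (-a) < 1 := Real.rpow_lt_one_of_one_lt_of_neg hp1 (by linarith)
  rw [norm_inv]
  congr 1
  rw [show (1 - (p : ℂ) ^ (-(a : ℂ))) = ((1 - (p : ℝ) ^ (-a) : ℝ) : ℂ) by
    push_cast [ofReal_cpow (Nat.cast_nonneg p)]; rfl]
  rw [norm_real, Real.norm_eq_abs, abs_of_pos (by linarith)]

lemma norm_mul_cpow_le_one (χ : DirichletCharacter ℂ N) (p : ℕ) (hp : p ≠ 0) (t : ℝ) :
    ‖χ p * (p : ℂ) ^ (-(t * I))‖ ≤ 1 := by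
  rw [norm_mul, norm_natCast_cpow_of_pos (Nat.pos_of_ne_zero hp)]
  simpa using χ.norm_le_one p

lemma one_sub_pos_of_norm {u : ℂ} (hu : ‖u‖ ≤ 1) {y : ℝ} (hy0 : 0 < y) (hy : y < 1) :
    0 < ‖1 - u * y‖ := by
  have h := norm_sub_norm_le (1 : ℂ) (u * y)
  rw [norm_one, norm_mul, norm_real, Real.norm_eq_abs, abs_of_pos hy0] at h
  nlinarith [norm_nonneg u]

/-- For `1 < a ≤ b` one has `|L(a + i t, χ) / L(b + i t, χ)| ≤ ζ(a) / ζ(b)`, one Euler factor at a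
time. -/
lemma norm_LFunction_mul_le [NeZero N] (χ : DirichletCharacter ℂ N) {a b : ℝ} (t : ℝ) (ha : 1 < a)
    (hab : a ≤ b) :
    ‖LFunction χ (a + t * I)‖ * ‖riemannZeta b‖ ≤
      ‖riemannZeta a‖ * ‖LFunction χ (b + t * I)‖ := by
  have hb := ha.trans_le hab
  refine le_of_tendsto_of_tendsto
    ((χ.tendsto_norm_eulerProduct (t := t) ha).mul (tendsto_eulerProduct_norm_riemannZeta hb))
    ((tendsto_eulerProduct_norm_riemannZeta ha).mul (χ.tendsto_norm_eulerProduct (t := t) hb))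
    (Eventually.of_forall fun n ↦ ?_)
  simp only [← Finset.prod_mul_distrib]
  refine Finset.prod_le_prod (fun p hp ↦ ?_) fun p hp ↦ ?_
  all_goals
    have hpp := Nat.prime_of_mem_primesBelow hp
    have hp1 : (1 : ℝ) < p := by exact_mod_cast hpp.one_lt
    have hxa : (p : ℝ) ^ (-a) < 1 := Real.rpow_lt_one_of_one_lt_of_neg hp1 (by linarith)
    have hxb : (p : ℝ) ^ (-b) < 1 := Real.rpow_lt_one_of_one_lt_of_neg hp1 (by linarith)
    have hle : (p : ℝ) ^ (-b) ≤ (p : ℝ) ^ (-a) :=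
      Real.rpow_le_rpow_of_exponent_le hp1.le (by linarith)
    have hb0 : 0 < (p : ℝ) ^ (-b) := by positivity
    have hu := χ.norm_mul_cpow_le_one p hpp.ne_zero t
  · exact mul_nonneg (inv_nonneg.2 (norm_nonneg _)) (inv_nonneg.2 (by linarith))
  · have key := norm_one_sub_mul_le hu hb0 hle hxa
    have h1 := one_sub_pos_of_norm hu (hb0.trans_le hle) hxa
    have h2 := one_sub_pos_of_norm hu hb0 hxb
    rw [← mul_inv, ← mul_inv]
    refine inv_anti₀ (mul_pos (by linarith) h2) ?_
    linarith

lemma one_le_norm_LFunction_mul [NeZero N] (χ : DirichletCharacter ℂ N) {a : ℝ} (t : ℝ)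
    (ha : 1 < a) : 1 ≤ ‖LFunction χ (a + t * I)‖ * ‖riemannZeta a‖ := by
  refine ge_of_tendsto
    ((χ.tendsto_norm_eulerProduct (t := t) ha).mul (tendsto_eulerProduct_norm_riemannZeta ha))
    (Eventually.of_forall fun n ↦ ?_)
  rw [← Finset.prod_mul_distrib]
  refine Finset.one_le_prod fun p hp ↦ ?_
  have hpp := Nat.prime_of_mem_primesBelow hp
  have hp1 : (1 : ℝ) < p := by exact_mod_cast hpp.one_lt
  have hxa : (p : ℝ) ^ (-a) < 1 := Real.rpow_lt_one_of_one_lt_of_neg hp1 (by linarith)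
  have ha0 : 0 < (p : ℝ) ^ (-a) := by positivity
  have hu := χ.norm_mul_cpow_le_one p hpp.ne_zero t
  have h1 := one_sub_pos_of_norm hu ha0 hxa
  have h2 : ‖1 - (χ p * (p : ℂ) ^ (-(t * I))) * ((p : ℝ) ^ (-a) : ℝ)‖ ≤ 1 + (p : ℝ) ^ (-a) := by
    refine (norm_sub_le _ _).trans ?_
    rw [norm_one, norm_mul, norm_real, Real.norm_eq_abs, abs_of_pos ha0]
    nlinarith
  rw [← mul_inv]
  refine (one_le_inv₀ (mul_pos h1 (by linarith))).2 ?_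
  nlinarith

lemma norm_LFunction_le_norm_riemannZeta [NeZero N] (χ : DirichletCharacter ℂ N) {a : ℝ} (t : ℝ)
    (ha : 1 < a) : ‖LFunction χ (a + t * I)‖ ≤ ‖riemannZeta a‖ := by
  refine le_of_tendsto_of_tendsto (χ.tendsto_norm_eulerProduct (t := t) ha)
    (tendsto_eulerProduct_norm_riemannZeta ha) (Eventually.of_forall fun n ↦ ?_)
  refine Finset.prod_le_prod (fun p hp ↦ inv_nonneg.2 (norm_nonneg _)) fun p hp ↦ ?_
  have hpp := Nat.prime_of_mem_primesBelow hp
  have hp1 : (1 : ℝ) < p := by exact_mod_cast hpp.one_lt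
  have hxa : (p : ℝ) ^ (-a) < 1 := Real.rpow_lt_one_of_one_lt_of_neg hp1 (by linarith)
  have ha0 : 0 < (p : ℝ) ^ (-a) := by positivity
  have hu := χ.norm_mul_cpow_le_one p hpp.ne_zero t
  refine inv_anti₀ (by linarith) ?_
  have h := norm_sub_norm_le (1 : ℂ) ((χ p * (p : ℂ) ^ (-(t * I))) * ((p : ℝ) ^ (-a) : ℝ))
  rw [norm_one, norm_mul _ (((p : ℝ) ^ (-a) : ℝ) : ℂ), norm_real, Real.norm_eq_abs,
    abs_of_pos ha0] at h
  nlinarith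

end DirichletCharacter

end EulerProduct

/-! ### The zeta function on the real axis -/

section RealZeta

open MeasureTheory

lemma integral_rpow_neg {a u v : ℝ} (ha : 1 < a) (hu : 0 < u) (huv : u ≤ v) :
    ∫ x in u..v, x ^ (-a) = (u ^ (1 - a) - v ^ (1 - a)) / (a - 1) := by
  rw [integral_rpow (Or.inr ⟨by linarith, by
    rw [Set.uIcc_of_le huv]; exact fun h ↦ absurd h.1 (by linarith)⟩)]
  have : a - 1 ≠ 0 := by linarith
  have h2 : -a + 1 ≠ 0 := by linarith
  rw [show -a + 1 = 1 - a by ring] at h2 ⊢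
  field_simp
  ring

lemma intervalIntegrable_rpow_neg {a u v : ℝ} (hu : 0 < u) (huv : u ≤ v) :
    IntervalIntegrable (fun x : ℝ ↦ x ^ (-a)) volume u v :=
  intervalIntegral.intervalIntegrable_rpow (Or.inr (by
    rw [Set.uIcc_of_le huv]; exact fun h ↦ absurd h.1 (by linarith)))

/-- The convex function `x ^ (-a)` lies above its tangents. -/
lemma tangent_le_rpow_neg {a x y : ℝ} (ha : 0 ≤ a) (hx : 0 < x) (hy : 0 < y) :
    x ^ (-a) * (1 - a * (y / x - 1)) ≤ y ^ (-a) := by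
  have hyx : 0 < y / x := by positivity
  have e : y ^ (-a) = x ^ (-a) * (y / x) ^ (-a) := by
    rw [← Real.mul_rpow hx.le hyx.le, mul_div_cancel₀ _ hx.ne']
  rw [e]
  gcongr
  rw [Real.rpow_def_of_pos hyx]
  have h1 := Real.add_one_le_exp (Real.log (y / x) * -a)
  have h2 := Real.log_le_sub_one_of_pos hyx
  nlinarith

/-- The midpoint rule underestimates the integral of the convex function `x ^ (-a)`. -/
lemma rpow_neg_le_midpoint {a x : ℝ} (ha : 1 < a) (hx : 1 / 2 < x) :
    x ^ (-a) ≤ ((x - 1 / 2) ^ (1 - a) - (x + 1 / 2) ^ (1 - a)) / (a - 1) := by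
  have hx0 : 0 < x := by linarith
  rw [← integral_rpow_neg ha (by linarith) (by linarith)]
  have hlin : ∫ y in (x - 1 / 2)..(x + 1 / 2), x ^ (-a) * (1 - a * (y / x - 1)) = x ^ (-a) := by
    rw [intervalIntegral.integral_const_mul, intervalIntegral.integral_sub (by simp)
      (Continuous.intervalIntegrable (by fun_prop) _ _), intervalIntegral.integral_const_mul,
      intervalIntegral.integral_sub (Continuous.intervalIntegrable (by fun_prop) _ _) (by simp),
      intervalIntegral.integral_div, integral_id]
    simp only [intervalIntegral.integral_const, smul_eq_mul, mul_one]
    field_simp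
    ring
  conv_lhs => rw [← hlin]
  refine intervalIntegral.integral_mono_on (by linarith)
    (Continuous.intervalIntegrable (by fun_prop) _ _)
    (intervalIntegrable_rpow_neg (by linarith) (by linarith)) fun y hy ↦ ?_
  exact tangent_le_rpow_neg (by linarith) hx0 (by linarith [hy.1])

/-- The trapezoidal rule overestimates the integral of the convex function `x ^ (-a)`. -/
lemma trapezoid_le_rpow_neg {a x : ℝ} (ha : 1 < a) (hx : 0 < x) :
    (x ^ (1 - a) - (x + 1) ^ (1 - a)) / (a - 1) ≤ (x ^ (-a) + (x + 1) ^ (-a)) / 2 := by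
  rw [← integral_rpow_neg ha hx (by linarith)]
  have hlin : ∫ y in x..(x + 1), ((x + 1 - y) * x ^ (-a) + (y - x) * (x + 1) ^ (-a)) =
      (x ^ (-a) + (x + 1) ^ (-a)) / 2 := by
    rw [intervalIntegral.integral_add (Continuous.intervalIntegrable (by fun_prop) _ _)
      (Continuous.intervalIntegrable (by fun_prop) _ _), intervalIntegral.integral_mul_const,
      intervalIntegral.integral_mul_const, intervalIntegral.integral_sub (by simp)
      (Continuous.intervalIntegrable (by fun_prop) _ _),
      intervalIntegral.integral_sub (Continuous.intervalIntegrable (by fun_prop) _ _) (by simp),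
      integral_id]
    simp only [intervalIntegral.integral_const, smul_eq_mul]
    ring
  rw [← hlin]
  refine intervalIntegral.integral_mono_on (by linarith)
    (intervalIntegrable_rpow_neg hx (by linarith))
    (Continuous.intervalIntegrable (by fun_prop) _ _) fun y hy ↦ ?_
  have hy0 : 0 < y := hx.trans_le hy.1
  have h1 := mul_le_mul_of_nonneg_left (tangent_le_rpow_neg (by linarith : 0 ≤ a) hy0 hx)
    (sub_nonneg.2 hy.2)
  have h2 := mul_le_mul_of_nonneg_left
    (tangent_le_rpow_neg (by linarith : 0 ≤ a) hy0 (by linarith : 0 < x + 1)) (sub_nonneg.2 hy.1)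
  calc y ^ (-a) = (x + 1 - y) * (y ^ (-a) * (1 - a * (x / y - 1))) +
        (y - x) * (y ^ (-a) * (1 - a * ((x + 1) / y - 1))) := by field_simp; ring
    _ ≤ _ := add_le_add h1 h2

lemma hasSum_norm_riemannZeta {a : ℝ} (ha : 1 < a) :
    HasSum (fun n : ℕ ↦ ((n : ℝ) + 1) ^ (-a)) ‖riemannZeta a‖ := by
  have hs : Summable fun n : ℕ ↦ ((n : ℝ) + 1) ^ (-a) := by
    have := (summable_nat_add_iff 1).2 (Real.summable_nat_rpow.2 (by linarith : -a < -1))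
    simpa using this
  have h : riemannZeta a = ((∑' n : ℕ, ((n : ℝ) + 1) ^ (-a) : ℝ) : ℂ) := by
    rw [zeta_eq_tsum_one_div_nat_add_one_cpow (by simpa using ha), Complex.ofReal_tsum]
    refine tsum_congr fun n ↦ ?_
    rw [Real.rpow_neg (by positivity), Complex.ofReal_inv, Complex.ofReal_cpow (by positivity)]
    simp
  rw [h, Complex.norm_real, Real.norm_of_nonneg (tsum_nonneg fun n ↦ by positivity)]
  exact hs.hasSum

lemma tendsto_natCast_add_rpow_neg {b c : ℝ} (hb : b < 0) :
    Filter.Tendsto (fun n : ℕ ↦ ((n : ℝ) + c) ^ b) Filter.atTop (nhds 0) := by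
  have := (tendsto_rpow_neg_atTop (neg_pos.2 hb)).comp
    (Filter.tendsto_atTop_add_const_right _ c tendsto_natCast_atTop_atTop)
  simpa [Function.comp_def] using this

/-- Midpoint rule for the terms `n ≥ 2` of the series. -/
lemma norm_riemannZeta_le {a : ℝ} (ha : 1 < a) :
    ‖riemannZeta a‖ ≤ 1 + (3 / 2) ^ (1 - a) / (a - 1) := by
  have h := (hasSum_nat_add_iff' 1).2 (hasSum_norm_riemannZeta ha)
  simp only [Finset.range_one, Finset.sum_singleton, Nat.cast_zero, zero_add,
    Real.one_rpow] at h
  set T : ℕ → ℝ := fun n ↦ ((n : ℝ) + 3 / 2) ^ (1 - a) / (a - 1) with hT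
  have hT0 : Filter.Tendsto T Filter.atTop (nhds 0) := by
    simpa using
      (tendsto_natCast_add_rpow_neg (c := 3 / 2) (by linarith : 1 - a < 0)).div_const (a - 1)
  have hstep : ∀ n : ℕ, (((n + 1 : ℕ) : ℝ) + 1) ^ (-a) ≤ T n - T (n + 1) := by
    intro n
    have hn : (0 : ℝ) ≤ n := n.cast_nonneg
    have := rpow_neg_le_midpoint ha (x := (n : ℝ) + 2) (by linarith)
    rw [hT]
    push_cast
    rw [← sub_div]
    rw [show (n : ℝ) + 2 - 1 / 2 = n + 3 / 2 by ring,
      show (n : ℝ) + 2 + 1 / 2 = n + 1 + 3 / 2 by ring,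
      show (n : ℝ) + 2 = n + 1 + 1 by ring] at this
    exact this
  have := le_of_tendsto_of_tendsto' h.tendsto_sum_nat (hT0.const_sub (T 0)) fun n ↦
    (Finset.sum_le_sum fun i _ ↦ hstep i).trans_eq (Finset.sum_range_sub' T n)
  simp only [hT, Nat.cast_zero, zero_add, sub_zero] at this
  linarith

/-- Trapezoidal rule for the terms `n ≥ 2` of the series. -/
lemma le_norm_riemannZeta {a : ℝ} (ha : 1 < a) :
    1 + 2 ^ (-a) * (2 / (a - 1) + 1 / 2) ≤ ‖riemannZeta a‖ := by
  have h := (hasSum_nat_add_iff' 1).2 (hasSum_norm_riemannZeta ha)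
  simp only [Finset.range_one, Finset.sum_singleton, Nat.cast_zero, zero_add,
    Real.one_rpow] at h
  set T : ℕ → ℝ := fun n ↦ ((n : ℝ) + 2) ^ (1 - a) / (a - 1) + ((n : ℝ) + 2) ^ (-a) / 2 with hT
  have hT0 : Filter.Tendsto T Filter.atTop (nhds 0) := by
    simpa using ((tendsto_natCast_add_rpow_neg (c := 2) (by linarith : 1 - a < 0)).div_const
      (a - 1)).add ((tendsto_natCast_add_rpow_neg (c := 2) (by linarith : -a < 0)).div_const 2)
  have hstep : ∀ n : ℕ, T n - T (n + 1) ≤ (((n + 1 : ℕ) : ℝ) + 1) ^ (-a) := by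
    intro n
    have hn : (0 : ℝ) ≤ n := n.cast_nonneg
    have := trapezoid_le_rpow_neg ha (x := (n : ℝ) + 2) (by linarith)
    rw [hT]
    push_cast
    rw [sub_div] at this
    rw [show (n : ℝ) + 1 + 1 = n + 2 by ring, show (n : ℝ) + 1 + 2 = n + 2 + 1 by ring]
    linarith
  have := le_of_tendsto_of_tendsto' (hT0.const_sub (T 0)) h.tendsto_sum_nat fun n ↦
    (Finset.sum_range_sub' T n).symm.trans_le (Finset.sum_le_sum fun i _ ↦ hstep i)
  simp only [hT, Nat.cast_zero, zero_add, sub_zero] at this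
  rw [sub_eq_add_neg 1 a, Real.rpow_add two_pos, Real.rpow_one] at this
  have e : (2 : ℝ) ^ (-a) * (2 / (a - 1) + 1 / 2) = 2 * 2 ^ (-a) / (a - 1) + 2 ^ (-a) / 2 := by ring
  linarith

lemma norm_riemannZeta_le_div {a : ℝ} (ha : 1 < a) : ‖riemannZeta a‖ ≤ a / (a - 1) := by
  refine (norm_riemannZeta_le ha).trans ?_
  have h1 : ((3 : ℝ) / 2) ^ (1 - a) ≤ 1 :=
    Real.rpow_le_one_of_one_le_of_nonpos (by norm_num) (by linarith)
  have h2 : 0 < a - 1 := by linarith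
  rw [le_div_iff₀ h2, add_mul, div_mul_cancel₀ _ h2.ne']
  linarith

end RealZeta

/-! ### The functional equation on the line `re s = 0` -/

section ConvexityBound

open Complex

namespace DirichletCharacter

variable {N : ℕ}

lemma norm_gammaFactor_inv_one_sub_le (χ : DirichletCharacter ℂ N) {t : ℝ}
    (ht : χ.gammaFactor (t * I) ≠ 0) :
    ‖χ⁻¹.gammaFactor (1 - t * I)‖ ^ 4 ≤
      (t ^ 2 + 2 / 3) / (2 * Real.pi) ^ 2 * ‖χ.gammaFactor (t * I)‖ ^ 4 := by
  rcases χ.even_or_odd with h | h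
  · have h' : χ⁻¹.Even := by
      change χ⁻¹ (-1) = 1
      rw [MulChar.inv_apply_eq_inv, show χ (-1) = 1 from h, Ring.inverse_one]
    rw [h.gammaFactor_def] at ht
    rw [h.gammaFactor_def, h'.gammaFactor_def]
    refine norm_Gammaℝ_one_sub_le fun h0 ↦ ht ?_
    rw [h0, Gammaℝ_eq_zero_iff]
    exact ⟨0, by simp⟩
  · have h' : χ⁻¹.Odd := by
      change χ⁻¹ (-1) = -1
      rw [MulChar.inv_apply_eq_inv, show χ (-1) = -1 from h]
      simp
    rw [h.gammaFactor_def, h'.gammaFactor_def, show (1 - t * I + 1 : ℂ) = 2 - t * I by ring,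
      add_comm (t * I : ℂ)]
    exact norm_Gammaℝ_two_sub_le t

lemma gammaFactor_ne_zero_of_re_pos (χ : DirichletCharacter ℂ N) {s : ℂ} (hs : 0 < s.re) :
    χ.gammaFactor s ≠ 0 := by
  rcases χ.even_or_odd with h | h <;> rw [h.gammaFactor_def]
  · exact Gammaℝ_ne_zero_of_re_pos hs
  · exact Gammaℝ_ne_zero_of_re_pos (by rw [add_re, one_re]; linarith)

/-- The functional equation on the line `re s = 0`, with the Gamma quotient estimated. At a zero of
`gammaFactor χ` (a pole of the Gamma factor, taking the value `0`) the left-hand side is `0`. -/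
lemma IsPrimitive.norm_LFunction_mul_I_le [NeZero N] {χ : DirichletCharacter ℂ N}
    (hχ : χ.IsPrimitive) (hN : N ≠ 1) (t : ℝ) :
    ‖LFunction χ (t * I)‖ ≤
      Real.exp (1 / 2 * Real.log (N / (2 * Real.pi)) + 1 / 4 * Real.log (t ^ 2 + 2 / 3)) *
        ‖LFunction χ⁻¹ (1 - t * I)‖ := by
  have hpi := Real.pi_pos
  have hN0 : (0 : ℝ) < N := Nat.cast_pos.2 (NeZero.pos N)
  rw [LFunction_eq_completed_div_gammaFactor χ _ (Or.inr hN)]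
  by_cases hγ : χ.gammaFactor (t * I) = 0
  · rw [hγ, div_zero, norm_zero]; positivity
  have hγ' := χ⁻¹.gammaFactor_ne_zero_of_re_pos (s := 1 - t * I) (by simp)
  have hΛ : completedLFunction χ⁻¹ (1 - t * I) =
      LFunction χ⁻¹ (1 - t * I) * χ⁻¹.gammaFactor (1 - t * I) := by
    rw [LFunction_eq_completed_div_gammaFactor χ⁻¹ _ (Or.inr hN), div_mul_cancel₀ _ hγ']
  have hfe := hχ.completedLFunction_one_sub (1 - t * I)
  rw [sub_sub_cancel, hΛ] at hfe
  have hNp : ‖(N : ℂ) ^ ((1 - t * I) - 1 / 2 : ℂ)‖ ^ 4 = N ^ 2 := by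
    rw [norm_natCast_cpow_of_pos (NeZero.pos N), ← Real.rpow_natCast, ← Real.rpow_mul hN0.le,
      ← Real.rpow_natCast]
    norm_num
  set R := Real.exp (1 / 2 * Real.log (N / (2 * Real.pi)) + 1 / 4 * Real.log (t ^ 2 + 2 / 3))
  have hR : R ^ 4 = N ^ 2 * ((t ^ 2 + 2 / 3) / (2 * Real.pi) ^ 2) := by
    rw [← Real.exp_nat_mul, show ((4 : ℕ) : ℝ) * (1 / 2 * Real.log (N / (2 * Real.pi)) +
      1 / 4 * Real.log (t ^ 2 + 2 / 3)) = (2 : ℕ) * Real.log (N / (2 * Real.pi)) +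
      Real.log (t ^ 2 + 2 / 3) by push_cast; ring, Real.exp_add, Real.exp_nat_mul,
      Real.exp_log (by positivity), Real.exp_log (by positivity)]
    field_simp
  rw [norm_div, div_le_iff₀ (norm_pos_iff.2 hγ),
    ← pow_le_pow_iff_left₀ (norm_nonneg _) (by positivity) four_ne_zero, hfe]
  simp only [norm_mul, mul_pow, hNp, hχ.norm_rootNumber, one_pow, hR]
  have := norm_gammaFactor_inv_one_sub_le χ hγ
  calc (N : ℝ) ^ 2 * 1 * (‖LFunction χ⁻¹ (1 - t * I)‖ ^ 4 * ‖χ⁻¹.gammaFactor (1 - t * I)‖ ^ 4)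
      ≤ (N : ℝ) ^ 2 * 1 * (‖LFunction χ⁻¹ (1 - t * I)‖ ^ 4 *
        ((t ^ 2 + 2 / 3) / (2 * Real.pi) ^ 2 * ‖χ.gammaFactor (t * I)‖ ^ 4)) := by gcongr
    _ = _ := by ring

end DirichletCharacter

/-! ### The comparison function for the Gamma quotient -/

/-- A cubic polynomial in `s` whose real part, harmonic in the strip, bounds
`(1 / 4) * log (t ^ 2 + 2 / 3)` from above at `s = t * I` and vanishes on the line `re s = 1`. It
comes from the tangent `log y ≤ log X - 1 + y / X` of the logarithm at the parameter `X`, with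
`t ^ 2 + 2 / 3` and `1` on the line `re s = 0` replaced by their harmonic extensions that vanish on
`re s = 1`. Choosing `X` according to the point of interest loses nothing there. -/
noncomputable def logComparison (X : ℝ) (s : ℂ) : ℂ :=
  1 / 4 * ((1 - s) * ((Real.log X - 1 : ℝ) : ℂ) + ((1 - s) - (1 - s) ^ 3 / 3) / (X : ℂ))

lemma logComparison_re (X : ℝ) (s : ℂ) :
    (logComparison X s).re = (1 - s.re) / 4 *
      (Real.log X - 1 + (s.im ^ 2 + 1 - (1 - s.re) ^ 2 / 3) / X) := by
  have h : logComparison X s = ((1 / 4 * (Real.log X - 1) : ℝ) : ℂ) * (1 - s) +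
      ((1 / (4 * X) : ℝ) : ℂ) * ((1 - s) - ((1 / 3 : ℝ) : ℂ) * (1 - s) ^ 3) := by
    rw [logComparison]
    push_cast
    ring
  have h3 : ((1 - s) ^ 3).re = (1 - s.re) ^ 3 - 3 * (1 - s.re) * s.im ^ 2 := by
    simp [pow_succ]
    ring
  rw [h, add_re, re_ofReal_mul, re_ofReal_mul, sub_re (1 - s), re_ofReal_mul, h3, sub_re, one_re]
  ring

lemma logComparison_re_ge {X : ℝ} (hX : 1 ≤ X) {s : ℂ} (hs0 : 0 ≤ s.re) (hs1 : s.re ≤ 1) :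
    -(1 / 4) ≤ (logComparison X s).re := by
  rw [logComparison_re]
  have h1 := Real.log_nonneg hX
  have h2 : 0 ≤ (s.im ^ 2 + 1 - (1 - s.re) ^ 2 / 3) / X := by
    refine div_nonneg ?_ (by linarith)
    nlinarith [sq_nonneg s.im]
  nlinarith [mul_nonneg (sub_nonneg.2 hs1) (add_nonneg h1 h2)]

lemma log_le_logComparison_re {X : ℝ} (hX : 0 < X) (t : ℝ) :
    1 / 4 * Real.log (t ^ 2 + 2 / 3) ≤ (logComparison X (t * I)).re := by
  rw [logComparison_re]
  have h := Real.log_le_sub_one_of_pos (show 0 < (t ^ 2 + 2 / 3) / X by positivity)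
  rw [Real.log_div (by positivity) hX.ne'] at h
  simp
  rw [show t ^ 2 + 1 - 3⁻¹ = t ^ 2 + 2 / 3 by ring]
  linarith

/-- At the point whose ordinate determines the parameter `X`, the comparison function is at most the
linear interpolation of `(1 / 4) * log (1 + t ^ 2)` and `0`. -/
lemma logComparison_re_le {s : ℂ} (hs1 : s.re ≤ 1) :
    (logComparison (1 + s.im ^ 2) s).re ≤ (1 - s.re) / 4 * Real.log (1 + s.im ^ 2) := by
  rw [logComparison_re]
  have h : (s.im ^ 2 + 1 - (1 - s.re) ^ 2 / 3) / (1 + s.im ^ 2) ≤ 1 := by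
    rw [div_le_one (by positivity)]
    nlinarith [sq_nonneg (1 - s.re)]
  have : 0 ≤ (1 - s.re) / 4 := by linarith
  gcongr
  linarith

/-! ### The convexity bound -/

/-- The constant in the convexity bound on the line `re s = σ`: the real zeta values that bound the
quotients of `L`-values in `DirichletCharacter.normalizedLFunction` at `s` with `re s = σ`, times
the bound `ζ(3)` for that function on the edges of the strip. -/
noncomputable def convexityConstant (σ : ℝ) : ℝ :=
  ‖riemannZeta (3 : ℝ)‖ * (‖riemannZeta (2 - σ : ℝ)‖ / ‖riemannZeta (2 + σ : ℝ)‖) *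
    (‖riemannZeta (1 + σ : ℝ)‖ / ‖riemannZeta (3 - σ : ℝ)‖)

namespace DirichletCharacter

variable {N : ℕ} [NeZero N]

/-- The `L`-function divided by an analytic majorant on the strip `0 ≤ re s ≤ 1`. The quotient of
four `L`-values has modulus `|L(3 + i t, χ) / L(1 + i t, χ)|` on both edges, which cancels the factor
`|L(1 + i t, χ)|` without estimating it; the exponential takes care of the factor that the
functional equation contributes on the left edge. -/
noncomputable def normalizedLFunction (χ : DirichletCharacter ℂ N) (X : ℝ) (s : ℂ) : ℂ :=
  LFunction χ s * (LFunction χ (2 + s) * LFunction χ⁻¹ (3 - s)) /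
    (LFunction χ⁻¹ (2 - s) * LFunction χ (1 + s)) *
    exp (-((1 - s) / 2 * (Real.log (N / (2 * Real.pi)) : ℝ) + logComparison X s))

lemma normalizedLFunction_diffContOnCl {χ : DirichletCharacter ℂ N} (hχ : χ ≠ 1) (X : ℝ) :
    DiffContOnCl ℂ (χ.normalizedLFunction X) (re ⁻¹' Set.Ioo 0 1) := by
  have hχ' : χ⁻¹ ≠ 1 := inv_ne_one.2 hχ
  have hd := differentiable_LFunction hχ
  have hd' := differentiable_LFunction hχ'
  refine DifferentiableOn.diffContOnCl fun s hs ↦ ?_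
  rw [closure_preimage_re, closure_Ioo zero_ne_one] at hs
  have hs' : 0 ≤ s.re ∧ s.re ≤ 1 := hs
  refine DifferentiableAt.differentiableWithinAt ?_
  have h1 : LFunction χ⁻¹ (2 - s) ≠ 0 :=
    LFunction_ne_zero_of_one_le_re _ (Or.inl hχ') (by rw [sub_re, re_ofNat]; linarith)
  have h2 : LFunction χ (1 + s) ≠ 0 :=
    LFunction_ne_zero_of_one_le_re _ (Or.inl hχ) (by rw [add_re, one_re]; linarith)
  have c1 : DifferentiableAt ℂ (fun s ↦ LFunction χ (2 + s)) s :=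
    (hd.comp (differentiable_id.const_add 2)).differentiableAt
  have c2 : DifferentiableAt ℂ (fun s ↦ LFunction χ⁻¹ (3 - s)) s :=
    (hd'.comp (differentiable_id.const_sub 3)).differentiableAt
  have c3 : DifferentiableAt ℂ (fun s ↦ LFunction χ⁻¹ (2 - s)) s :=
    (hd'.comp (differentiable_id.const_sub 2)).differentiableAt
  have c4 : DifferentiableAt ℂ (fun s ↦ LFunction χ (1 + s)) s :=
    (hd.comp (differentiable_id.const_add 1)).differentiableAt
  refine ((hd.differentiableAt.mul (c1.mul c2)).div (c3.mul c4) (mul_ne_zero h1 h2)).mul ?_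
  unfold logComparison
  fun_prop

lemma norm_LFunction_ne_zero {χ : DirichletCharacter ℂ N} (hχ : χ ≠ 1) {s : ℂ}
    (hs : 1 ≤ s.re) : ‖LFunction χ s‖ ≠ 0 :=
  norm_ne_zero_iff.2 (LFunction_ne_zero_of_one_le_re _ (Or.inl hχ) hs)

/-- `norm_LFunction_inv_conj` on the vertical line `re s = a`. -/
lemma norm_LFunction_inv_sub_mul_I (χ : DirichletCharacter ℂ N) {a : ℝ} (ha : 1 < a) (t : ℝ) :
    ‖LFunction χ⁻¹ (a - t * I)‖ = ‖LFunction χ (a + t * I)‖ := by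
  have := norm_LFunction_inv_conj_of_one_lt_re χ (s := a + t * I) (by simpa using ha)
  simpa [sub_eq_add_neg] using this

lemma norm_normalizedLFunction_right {χ : DirichletCharacter ℂ N} (hχ : χ ≠ 1) (X t : ℝ) :
    ‖χ.normalizedLFunction X (1 + t * I)‖ ≤ ‖riemannZeta (3 : ℝ)‖ := by
  have e2 := norm_LFunction_inv_sub_mul_I χ one_lt_two t
  have e3 := χ.norm_LFunction_le_norm_riemannZeta (a := 3) t (by norm_num)
  have n1 := norm_LFunction_ne_zero hχ (s := 1 + t * I) (by simp)
  have n2 := norm_LFunction_ne_zero hχ (s := 2 + t * I) (by simp)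
  push_cast at e2 e3 ⊢
  rw [normalizedLFunction, show (2 + (1 + t * I) : ℂ) = 3 + t * I by ring,
    show (3 - (1 + t * I) : ℂ) = 2 - t * I by ring,
    show (2 - (1 + t * I) : ℂ) = 1 - t * I by ring,
    show (1 + (1 + t * I) : ℂ) = 2 + t * I by ring, norm_mul, norm_exp, norm_div, norm_mul,
    norm_mul, norm_mul, norm_LFunction_inv_conj hχ, e2]
  have hre : (-((1 - (1 + t * I)) / 2 * (Real.log (N / (2 * Real.pi)) : ℝ) +
      logComparison X (1 + t * I))).re = 0 := by
    rw [neg_re, add_re, logComparison_re, re_mul_ofReal]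
    simp
  rw [hre, Real.exp_zero, mul_one]
  convert! e3 using 1
  field_simp

lemma norm_normalizedLFunction_left {χ : DirichletCharacter ℂ N} (hχ : χ ≠ 1)
    (hp : χ.IsPrimitive) {X : ℝ} (hX : 0 < X) (t : ℝ) :
    ‖χ.normalizedLFunction X (t * I)‖ ≤ ‖riemannZeta (3 : ℝ)‖ := by
  have e2 := norm_LFunction_inv_sub_mul_I χ one_lt_two t
  have e4 := norm_LFunction_inv_sub_mul_I χ (a := 3) (by norm_num) t
  have e3 := χ.norm_LFunction_le_norm_riemannZeta (a := 3) t (by norm_num)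
  have n1 := norm_LFunction_ne_zero hχ (s := 1 + t * I) (by simp)
  have n2 := norm_LFunction_ne_zero hχ (s := 2 + t * I) (by simp)
  have hN : N ≠ 1 := fun h1 ↦ hχ (χ.level_one' h1)
  have hL := hp.norm_LFunction_mul_I_le hN t
  rw [norm_LFunction_inv_conj hχ] at hL
  push_cast at e2 e3 e4 ⊢
  rw [normalizedLFunction, norm_mul, norm_exp, norm_div, norm_mul, norm_mul, norm_mul, e2, e4]
  have hre : (-((1 - t * I) / 2 * (Real.log (N / (2 * Real.pi)) : ℝ) +
      logComparison X (t * I))).re ≤ -(1 / 2 * Real.log (N / (2 * Real.pi)) +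
        1 / 4 * Real.log (t ^ 2 + 2 / 3)) := by
    have := log_le_logComparison_re hX t
    rw [neg_re, add_re, re_mul_ofReal]
    simp at this ⊢
    linarith
  have hexp := Real.exp_le_exp.2 hre
  set r := 1 / 2 * Real.log (N / (2 * Real.pi)) + 1 / 4 * Real.log (t ^ 2 + 2 / 3)
  calc _ ≤ Real.exp r * ‖LFunction χ (1 + t * I)‖ * (‖LFunction χ (2 + t * I)‖ *
        ‖LFunction χ (3 + t * I)‖) / (‖LFunction χ (2 + t * I)‖ * ‖LFunction χ (1 + t * I)‖) *
        Real.exp (-r) := by gcongr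
    _ = ‖LFunction χ (3 + t * I)‖ := by
        rw [Real.exp_neg]
        field_simp
    _ ≤ _ := e3

lemma norm_LFunction_le_norm_riemannZeta_re (χ : DirichletCharacter ℂ N) {s : ℂ}
    (hs : 1 < s.re) : ‖LFunction χ s‖ ≤ ‖riemannZeta s.re‖ := by
  have := χ.norm_LFunction_le_norm_riemannZeta s.im hs
  rwa [re_add_im] at this

lemma one_le_norm_LFunction_mul_re (χ : DirichletCharacter ℂ N) {s : ℂ}
    (hs : 1 < s.re) : 1 ≤ ‖LFunction χ s‖ * ‖riemannZeta s.re‖ := by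
  have := χ.one_le_norm_LFunction_mul s.im hs
  rwa [re_add_im] at this

lemma norm_normalizedLFunction_le_growth {χ : DirichletCharacter ℂ N} (hχ : χ ≠ 1) {X : ℝ}
    (hX : 1 ≤ X) {s : ℂ} (hs0 : 0 < s.re) (hs1 : s.re < 1) :
    ‖χ.normalizedLFunction X s‖ ≤
      16 * N * Real.exp (|Real.log (N / (2 * Real.pi))| + 1 / 4) * (1 + |s.im|) /
        (s.re * (1 - s.re)) ^ 2 := by
  have hupper : ∀ (ψ : DirichletCharacter ℂ N) (z : ℂ), 2 ≤ z.re → ‖LFunction ψ z‖ ≤ 2 := by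
    intro ψ z hz
    refine (ψ.norm_LFunction_le_norm_riemannZeta_re (by linarith)).trans
      ((norm_riemannZeta_le_div (by linarith)).trans ?_)
    rw [div_le_iff₀ (by linarith)]
    linarith
  have hlower : ∀ (ψ : DirichletCharacter ℂ N) (z : ℂ), 1 < z.re → z.re ≤ 2 →
      (z.re - 1) / 2 ≤ ‖LFunction ψ z‖ := by
    intro ψ z hz hz2
    have hz0 : 0 < z.re - 1 := by linarith
    have h1 := (ψ.one_le_norm_LFunction_mul_re hz).trans
      (mul_le_mul_of_nonneg_left (norm_riemannZeta_le_div hz) (norm_nonneg _))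
    rw [← mul_div_assoc, le_div_iff₀ hz0, one_mul] at h1
    nlinarith [norm_nonneg (LFunction ψ z)]
  have b1 : ‖LFunction χ s‖ ≤ N * (1 + |s.im|) / s.re := by
    refine (norm_LFunction_le_of_re_pos hχ hs0).trans ?_
    have := norm_le_abs_re_add_abs_im s
    rw [abs_of_pos hs0] at this
    gcongr
    linarith
  have b2 := hupper χ (2 + s) (by rw [add_re, re_ofNat]; linarith)
  have b3 := hupper χ⁻¹ (3 - s) (by rw [sub_re, re_ofNat]; linarith)
  have b4 := hlower χ⁻¹ (2 - s) (by rw [sub_re, re_ofNat]; linarith)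
    (by rw [sub_re, re_ofNat]; linarith)
  have b5 := hlower χ (1 + s) (by rw [add_re, one_re]; linarith)
    (by rw [add_re, one_re]; linarith)
  rw [show ((2 - s).re - 1) / 2 = (1 - s.re) / 2 by rw [sub_re, re_ofNat]; ring] at b4
  rw [show ((1 + s).re - 1) / 2 = s.re / 2 by rw [add_re, one_re]; ring] at b5
  have b6 : (-((1 - s) / 2 * (Real.log (N / (2 * Real.pi)) : ℝ) + logComparison X s)).re ≤
      |Real.log (N / (2 * Real.pi))| + 1 / 4 := by
    have h1 := logComparison_re_ge hX hs0.le hs1.le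
    have h2 : ((1 - s) / 2).re = (1 - s.re) / 2 := by simp
    rw [neg_re, add_re, re_mul_ofReal, h2]
    have h3 := neg_abs_le (Real.log (N / (2 * Real.pi)))
    have h4 : 0 ≤ |Real.log (N / (2 * Real.pi))| := abs_nonneg _
    nlinarith
  have b7 := Real.exp_le_exp.2 b6
  have hs1' : 0 < 1 - s.re := by linarith
  rw [normalizedLFunction, norm_mul, norm_exp, norm_div, norm_mul, norm_mul, norm_mul]
  set D := Real.exp (|Real.log (N / (2 * Real.pi))| + 1 / 4)
  have hD : 0 < D := Real.exp_pos _
  calc _ ≤ N * (1 + |s.im|) / s.re * (2 * 2) / ((1 - s.re) / 2 * (s.re / 2)) * D := by gcongr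
    _ = 16 * N * D * (1 + |s.im|) * (1 - s.re) / (s.re * (1 - s.re)) ^ 2 := by
        field_simp
        ring
    _ ≤ 16 * N * D * (1 + |s.im|) * 1 / (s.re * (1 - s.re)) ^ 2 := by
        gcongr
        linarith
    _ = _ := by rw [mul_one]

lemma norm_LFunction_div_le {χ : DirichletCharacter ℂ N} (hχ : χ ≠ 1) {a b : ℝ} (t : ℝ)
    (ha : 1 < a) (hab : a ≤ b) :
    ‖LFunction χ (a + t * I)‖ / ‖LFunction χ (b + t * I)‖ ≤
      ‖riemannZeta a‖ / ‖riemannZeta b‖ := by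
  have h1 : 0 < ‖LFunction χ (b + t * I)‖ := norm_pos_iff.2
    (LFunction_ne_zero_of_one_le_re _ (Or.inl hχ) (by simpa using (ha.trans_le hab).le))
  have h2 : 0 < ‖riemannZeta b‖ := norm_pos_iff.2
    (riemannZeta_ne_zero_of_one_le_re (by simpa using (ha.trans_le hab).le))
  rw [div_le_div_iff₀ h1 h2]
  exact χ.norm_LFunction_mul_le t ha hab

/-- The convexity bound in the open strip `0 < re s < 1`, without logarithm and without epsilon. -/
theorem IsPrimitive.norm_LFunction_le {χ : DirichletCharacter ℂ N} (hp : χ.IsPrimitive)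
    (hχ : χ ≠ 1) {s : ℂ} (hs0 : 0 < s.re) (hs1 : s.re < 1) :
    ‖LFunction χ s‖ ≤ convexityConstant s.re *
      Real.exp ((1 - s.re) / 2 * Real.log (N / (2 * Real.pi)) +
        (1 - s.re) / 4 * Real.log (1 + s.im ^ 2)) := by
  have hX : 1 ≤ 1 + s.im ^ 2 := by nlinarith [sq_nonneg s.im]
  have hG : ‖χ.normalizedLFunction (1 + s.im ^ 2) s‖ ≤ ‖riemannZeta (3 : ℝ)‖ :=
    norm_le_of_edges_of_growth (normalizedLFunction_diffContOnCl hχ _)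
      (norm_normalizedLFunction_left hχ hp (by positivity)) (norm_normalizedLFunction_right hχ _)
      (fun z h0 h1 ↦ norm_normalizedLFunction_le_growth hχ hX h0 h1) hs0 hs1
  have hA : ((1 - s) / 2 * (Real.log (N / (2 * Real.pi)) : ℝ) +
      logComparison (1 + s.im ^ 2) s).re ≤ (1 - s.re) / 2 * Real.log (N / (2 * Real.pi)) +
        (1 - s.re) / 4 * Real.log (1 + s.im ^ 2) := by
    rw [add_re, re_mul_ofReal]
    have h2 : ((1 - s) / 2).re = (1 - s.re) / 2 := by simp
    rw [h2]
    exact add_le_add_right (logComparison_re_le hs1.le) _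
  have e1 : ‖LFunction χ⁻¹ (2 - s)‖ = ‖LFunction χ ((2 - s.re : ℝ) + s.im * I)‖ := by
    rw [← norm_LFunction_inv_sub_mul_I χ (by linarith)]
    conv_lhs => rw [← re_add_im s]
    push_cast
    ring_nf
  have e2 : ‖LFunction χ⁻¹ (3 - s)‖ = ‖LFunction χ ((3 - s.re : ℝ) + s.im * I)‖ := by
    rw [← norm_LFunction_inv_sub_mul_I χ (by linarith)]
    conv_lhs => rw [← re_add_im s]
    push_cast
    ring_nf
  have e3 : 2 + s = (2 + s.re : ℝ) + s.im * I := by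
    conv_lhs => rw [← re_add_im s]
    push_cast
    ring
  have e4 : 1 + s = (1 + s.re : ℝ) + s.im * I := by
    conv_lhs => rw [← re_add_im s]
    push_cast
    ring
  have r1 := norm_LFunction_div_le hχ s.im (by linarith : 1 < 2 - s.re)
    (by linarith : 2 - s.re ≤ 2 + s.re)
  have r2 := norm_LFunction_div_le hχ s.im (by linarith : 1 < 1 + s.re)
    (by linarith : 1 + s.re ≤ 3 - s.re)
  rw [normalizedLFunction, norm_mul, norm_exp, neg_re, norm_div, norm_mul, norm_mul, norm_mul,
    e1, e2, e3, e4, Real.exp_neg] at hG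
  have n1 := norm_LFunction_ne_zero hχ (s := (2 - s.re : ℝ) + s.im * I) (by simp; linarith)
  have n2 := norm_LFunction_ne_zero hχ (s := (3 - s.re : ℝ) + s.im * I) (by simp; linarith)
  have n3 := norm_LFunction_ne_zero hχ (s := (2 + s.re : ℝ) + s.im * I) (by simp; linarith)
  have n4 := norm_LFunction_ne_zero hχ (s := (1 + s.re : ℝ) + s.im * I) (by simp; linarith)
  set l1 := ‖LFunction χ ((2 - s.re : ℝ) + s.im * I)‖
  set l2 := ‖LFunction χ ((3 - s.re : ℝ) + s.im * I)‖
  set l3 := ‖LFunction χ ((2 + s.re : ℝ) + s.im * I)‖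
  set l4 := ‖LFunction χ ((1 + s.re : ℝ) + s.im * I)‖
  have hE := Real.exp_le_exp.2 hA
  set E := Real.exp ((1 - s) / 2 * (Real.log (N / (2 * Real.pi)) : ℝ) +
    logComparison (1 + s.im ^ 2) s).re
  have hE0 : 0 < E := Real.exp_pos _
  calc ‖LFunction χ s‖ = ‖LFunction χ s‖ * (l3 * l2) / (l1 * l4) * E⁻¹ * (l1 / l3) * (l4 / l2) *
        E := by field_simp
    _ ≤ convexityConstant s.re * _ := by
        rw [convexityConstant]
        gcongr

lemma exp_log_eq_rpow (τ t : ℝ) :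
    Real.exp (τ / 2 * Real.log (N / (2 * Real.pi)) + τ / 4 * Real.log (1 + t ^ 2)) =
      ((N : ℝ) * ‖1 + (t : ℂ) * I‖) ^ (τ / 2) / (2 * Real.pi) ^ (τ / 2) := by
  have hpi := Real.pi_pos
  have hN0 : (0 : ℝ) < N := Nat.cast_pos.2 (NeZero.pos N)
  have h1 : ‖1 + (t : ℂ) * I‖ = Real.sqrt (1 + t ^ 2) := by
    have := norm_add_mul_I 1 t
    simpa using this
  have h2 : 0 < 1 + t ^ 2 := by positivity
  rw [h1, ← Real.div_rpow (by positivity) (by positivity), mul_div_right_comm,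
    Real.rpow_def_of_pos (by positivity), Real.log_mul (by positivity) (by positivity),
    Real.log_sqrt h2.le]
  ring_nf

theorem IsPrimitive.norm_LFunction_le_of_convexityConstant_le {χ : DirichletCharacter ℂ N}
    (hp : χ.IsPrimitive) (hχ : χ ≠ 1) {σ C : ℝ} (hs0 : 0 < σ) (hs1 : σ < 1)
    (hC : convexityConstant σ ≤ C * (2 * Real.pi) ^ ((1 - σ) / 2)) (t : ℝ) :
    ‖LFunction χ (σ + t * I)‖ ≤ C * ((N : ℝ) * ‖1 + (t : ℂ) * I‖) ^ ((1 - σ) / 2) := by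
  have h := hp.norm_LFunction_le hχ (s := σ + t * I) (by simpa) (by simpa)
  have hre : (σ + t * I : ℂ).re = σ := by simp
  have him : (σ + t * I : ℂ).im = t := by simp
  have hpi := Real.pi_pos
  rw [hre, him, exp_log_eq_rpow, ← mul_div_assoc, le_div_iff₀ (by positivity)] at h
  refine le_of_mul_le_mul_right (h.trans ?_) (by positivity : 0 < (2 * Real.pi) ^ ((1 - σ) / 2))
  calc _ ≤ C * (2 * Real.pi) ^ ((1 - σ) / 2) *
        ((N : ℝ) * ‖1 + (t : ℂ) * I‖) ^ ((1 - σ) / 2) := by gcongr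
    _ = _ := by ring

end DirichletCharacter

end ConvexityBound

/-! ### Numerical evaluation -/

lemma rpow_neg_div_le {x c : ℝ} (hx : 0 < x) (hc : 0 ≤ c) (m : ℕ) {n : ℕ} (hn : n ≠ 0)
    (h : 1 ≤ c ^ n * x ^ m) : x ^ (-(m / n : ℝ)) ≤ c := by
  have hn' : (n : ℝ) ≠ 0 := Nat.cast_ne_zero.2 hn
  rw [← pow_le_pow_iff_left₀ (by positivity) hc hn, ← Real.rpow_natCast, ← Real.rpow_mul hx.le,
    show -(m / n : ℝ) * n = -m by field_simp, Real.rpow_neg hx.le, Real.rpow_natCast,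
    inv_le_iff_one_le_mul₀ (by positivity)]
  exact h

lemma le_rpow_neg_div {x c : ℝ} (hx : 0 < x) (hc : 0 ≤ c) (m : ℕ) {n : ℕ} (hn : n ≠ 0)
    (h : c ^ n * x ^ m ≤ 1) : c ≤ x ^ (-(m / n : ℝ)) := by
  have hn' : (n : ℝ) ≠ 0 := Nat.cast_ne_zero.2 hn
  rw [← pow_le_pow_iff_left₀ hc (by positivity) hn, ← Real.rpow_natCast (_ ^ (_ : ℝ)),
    ← Real.rpow_mul hx.le,
    show -(m / n : ℝ) * n = -m by field_simp, Real.rpow_neg hx.le, Real.rpow_natCast,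
    ← one_div, le_div_iff₀ (by positivity)]
  exact h

lemma le_two_pi_rpow {c : ℝ} (hc : 0 ≤ c) {n : ℕ} (hn : n ≠ 0) (h : c ^ n ≤ 6.28) :
    c ≤ (2 * Real.pi) ^ (1 / n : ℝ) := by
  have hpi := Real.pi_gt_d2
  rw [one_div, Real.le_rpow_inv_iff_of_pos hc (by positivity) (by positivity), Real.rpow_natCast]
  linarith

lemma convexityConstant_le {σ r₁ r₂ r₃ r₄ p C : ℝ} (h0 : 0 < σ) (h1 : σ < 1)
    (hr₁ : (3 / 2 : ℝ) ^ (-(1 - σ)) ≤ r₁) (hr₂ : (3 / 2 : ℝ) ^ (-σ) ≤ r₂)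
    (hr₃ : r₃ ≤ (2 : ℝ) ^ (-(2 + σ))) (hr₄ : r₄ ≤ (2 : ℝ) ^ (-(3 - σ)))
    (hp : p ≤ (2 * Real.pi) ^ ((1 - σ) / 2)) (h₃ : 0 ≤ r₃) (h₄ : 0 ≤ r₄) (hC0 : 0 ≤ C)
    (hC : 11 / 9 * (1 + r₁ / (1 - σ)) * (1 + r₂ / σ) ≤
      C * p * ((1 + r₃ * (2 / (1 + σ) + 1 / 2)) * (1 + r₄ * (2 / (2 - σ) + 1 / 2)))) :
    convexityConstant σ ≤ C * (2 * Real.pi) ^ ((1 - σ) / 2) := by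
  have z3 : ‖riemannZeta (3 : ℝ)‖ ≤ 11 / 9 := by
    refine (norm_riemannZeta_le (by norm_num)).trans ?_
    rw [show (1 - 3 : ℝ) = -(2 : ℕ) by norm_num, Real.rpow_neg (by norm_num), Real.rpow_natCast]
    norm_num
  have z1 := norm_riemannZeta_le (a := 2 - σ) (by linarith)
  have z2 := norm_riemannZeta_le (a := 1 + σ) (by linarith)
  have z4 := le_norm_riemannZeta (a := 2 + σ) (by linarith)
  have z5 := le_norm_riemannZeta (a := 3 - σ) (by linarith)
  rw [show 1 - (2 - σ) = -(1 - σ) by ring, show 2 - σ - 1 = 1 - σ by ring] at z1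
  rw [show 1 - (1 + σ) = -σ by ring, show 1 + σ - 1 = σ by ring] at z2
  rw [show 2 + σ - 1 = 1 + σ by ring] at z4
  rw [show 3 - σ - 1 = 2 - σ by ring] at z5
  have hσ1 : 0 < 1 - σ := by linarith
  have hσ2 : 0 < 2 - σ := by linarith
  have y1 : ‖riemannZeta (2 - σ : ℝ)‖ ≤ 1 + r₁ / (1 - σ) := z1.trans (by gcongr)
  have y2 : ‖riemannZeta (1 + σ : ℝ)‖ ≤ 1 + r₂ / σ := z2.trans (by gcongr)
  have y4 : 1 + r₃ * (2 / (1 + σ) + 1 / 2) ≤ ‖riemannZeta (2 + σ : ℝ)‖ :=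
    le_trans (by gcongr) z4
  have y5 : 1 + r₄ * (2 / (2 - σ) + 1 / 2) ≤ ‖riemannZeta (3 - σ : ℝ)‖ :=
    le_trans (by gcongr) z5
  have p4 : 0 < 1 + r₃ * (2 / (1 + σ) + 1 / 2) := by positivity
  have p5 : 0 < 1 + r₄ * (2 / (2 - σ) + 1 / 2) := by positivity
  calc convexityConstant σ ≤ 11 / 9 * ((1 + r₁ / (1 - σ)) / (1 + r₃ * (2 / (1 + σ) + 1 / 2))) *
        ((1 + r₂ / σ) / (1 + r₄ * (2 / (2 - σ) + 1 / 2))) := by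
        rw [convexityConstant]
        have := (norm_nonneg _).trans y1
        have := (norm_nonneg _).trans y2
        gcongr
    _ = 11 / 9 * (1 + r₁ / (1 - σ)) * (1 + r₂ / σ) /
        ((1 + r₃ * (2 / (1 + σ) + 1 / 2)) * (1 + r₄ * (2 / (2 - σ) + 1 / 2))) := by
        field_simp
    _ ≤ C * p := by rwa [div_le_iff₀ (by positivity)]
    _ ≤ _ := by gcongr

lemma convexityConstant_three_quarters_le :
    convexityConstant (3 / 4) ≤ 5.13781 * (2 * Real.pi) ^ ((1 - 3 / 4 : ℝ) / 2) := by
  refine convexityConstant_le (r₁ := 0.90362) (r₂ := 0.7378) (r₃ := 0.14864) (r₄ := 0.21021)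
    (p := 1.25817) (by norm_num) (by norm_num) ?_ ?_ ?_ ?_ ?_ (by norm_num) (by norm_num)
    (by norm_num) (by norm_num)
  · convert rpow_neg_div_le (x := 3 / 2) (c := 0.90362) (by norm_num) (by norm_num) 1
      (n := 4) (by norm_num) (by norm_num) using 2
    norm_num
  · convert rpow_neg_div_le (x := 3 / 2) (c := 0.7378) (by norm_num) (by norm_num) 3
      (n := 4) (by norm_num) (by norm_num) using 2
    norm_num
  · convert le_rpow_neg_div (x := 2) (c := 0.14864) (by norm_num) (by norm_num) 11
      (n := 4) (by norm_num) (by norm_num) using 2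
    norm_num
  · convert le_rpow_neg_div (x := 2) (c := 0.21021) (by norm_num) (by norm_num) 9
      (n := 4) (by norm_num) (by norm_num) using 2
    norm_num
  · convert le_two_pi_rpow (c := 1.25817) (by norm_num) (n := 8) (by norm_num) (by norm_num) using 2
    norm_num

lemma convexityConstant_seven_eighths_le :
    convexityConstant (7 / 8) ≤ 9.49562 * (2 * Real.pi) ^ ((1 - 7 / 8 : ℝ) / 2) := by
  refine convexityConstant_le (r₁ := 0.95059) (r₂ := 0.70134) (r₃ := 0.1363) (r₄ := 0.22924)
    (p := 1.12167) (by norm_num) (by norm_num) ?_ ?_ ?_ ?_ ?_ (by norm_num) (by norm_num)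
    (by norm_num) (by norm_num)
  · convert rpow_neg_div_le (x := 3 / 2) (c := 0.95059) (by norm_num) (by norm_num) 1
      (n := 8) (by norm_num) (by norm_num) using 2
    norm_num
  · convert rpow_neg_div_le (x := 3 / 2) (c := 0.70134) (by norm_num) (by norm_num) 7
      (n := 8) (by norm_num) (by norm_num) using 2
    norm_num
  · convert le_rpow_neg_div (x := 2) (c := 0.1363) (by norm_num) (by norm_num) 23
      (n := 8) (by norm_num) (by norm_num) using 2
    norm_num
  · convert le_rpow_neg_div (x := 2) (c := 0.22924) (by norm_num) (by norm_num) 17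
      (n := 8) (by norm_num) (by norm_num) using 2
    norm_num
  · convert le_two_pi_rpow (c := 1.12167) (by norm_num) (n := 16) (by norm_num)
      (by norm_num) using 2
    norm_num

lemma convexityConstant_fifteen_sixteenths_le :
    convexityConstant (15 / 16) ≤ 18.23874 * (2 * Real.pi) ^ ((1 - 15 / 16 : ℝ) / 2) := by
  refine convexityConstant_le (r₁ := 0.97499) (r₂ := 0.68379) (r₃ := 0.13052) (r₄ := 0.23939)
    (p := 1.05908) (by norm_num) (by norm_num) ?_ ?_ ?_ ?_ ?_ (by norm_num) (by norm_num)
    (by norm_num) (by norm_num)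
  · convert rpow_neg_div_le (x := 3 / 2) (c := 0.97499) (by norm_num) (by norm_num) 1
      (n := 16) (by norm_num) (by norm_num) using 2
    norm_num
  · convert rpow_neg_div_le (x := 3 / 2) (c := 0.68379) (by norm_num) (by norm_num) 15
      (n := 16) (by norm_num) (by norm_num) using 2
    norm_num
  · convert le_rpow_neg_div (x := 2) (c := 0.13052) (by norm_num) (by norm_num) 47
      (n := 16) (by norm_num) (by norm_num) using 2
    norm_num
  · convert le_rpow_neg_div (x := 2) (c := 0.23939) (by norm_num) (by norm_num) 33
      (n := 16) (by norm_num) (by norm_num) using 2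
    norm_num
  · convert le_two_pi_rpow (c := 1.05908) (by norm_num) (n := 32) (by norm_num)
      (by norm_num) using 2
    norm_num

theorem proposition5p2 (q : ℕ) [NeZero q] (hq : 3 ≤ q) (χ : DirichletCharacter ℂ q)
    (hχ : χ.IsPrimitive) (t : ℝ) :
    ‖χ.LFunction (3 / 4 + t * Complex.I)‖
        ≤ (5.13781 : ℝ) * ((q : ℝ) * ‖1 + (t : ℂ) * Complex.I‖) ^ (1 / 8 : ℝ) ∧
      ‖χ.LFunction (7 / 8 + t * Complex.I)‖
        ≤ (9.49562 : ℝ) * ((q : ℝ) * ‖1 + (t : ℂ) * Complex.I‖) ^ (1 / 16 : ℝ) ∧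
      ‖χ.LFunction (15 / 16 + t * Complex.I)‖
        ≤ (18.23874 : ℝ) * ((q : ℝ) * ‖1 + (t : ℂ) * Complex.I‖) ^ (1 / 32 : ℝ) := by
  have h1 : χ ≠ 1 := by
    rintro rfl
    rw [DirichletCharacter.isPrimitive_def, DirichletCharacter.conductor_one] at hχ
    omega
  refine ⟨?_, ?_, ?_⟩
  · convert hχ.norm_LFunction_le_of_convexityConstant_le h1 (by norm_num) (by norm_num)
      convexityConstant_three_quarters_le t using 3 <;> norm_num
  · convert hχ.norm_LFunction_le_of_convexityConstant_le h1 (by norm_num) (by norm_num)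
      convexityConstant_seven_eighths_le t using 3 <;> norm_num
  · convert hχ.norm_LFunction_le_of_convexityConstant_le h1 (by norm_num) (by norm_num)
      convexityConstant_fifteen_sixteenths_le t using 3 <;> norm_num
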